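/- Let $q$ be a prime power and $\mathbb F_q$ the field with $q$ elements. For an integer $u\ge -1$ let $RM_q(u,2)=\{(f(P))_{P\in\mathbb F_q^2} : f\in\mathbb F_q[X,Y],\ \deg f\le u\}\subseteq \mathbb F_q^{\,n}$, $n=q^2$, where $\deg 0=-1$ (so $RM_q(-1,2)=\{0\}$). For linear codes $C_2\subseteq C_1\subseteq\mathbb F_q^{\,n}$ and $1\le m\le \dim C_1-\dim C_2$, the $m$-th relative generalized Hamming weight is $$M_m(C_1,C_2)=\min\{|J| : J\subseteq\{1,\dots,n\},\ \dim (C_1)_J-\dim (C_2)_J=m\},\qquad C_J=\{c\in C : c_i=0 \text{ for } i\notin J\},$$ and for $1\le r\le\dim C$ the $r$-th generalized Hamming weight is $d_r(C)=\min\{|\mathrm{supp}\,D| : D\subseteq C \text{ a linear subcode},\ \dim D=r\}$, where $\mathrm{supp}\,D=\{i : c_i\ne0\text{ for some } c\in D\}$. **Relative weights.** Let $u_2\ge-1$ and $t\ge1$ be integers with $u_2+t\le 2(q-1)$, let $C_2=RM_q(u_2,2)$, $C_1=RM_q(u_2+t,2)$ and $\ell=\dim C_1-\dim C_2$. Below,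 $m$, $a$, $b$, $c$ denote integers; each item says that for every $m$ in the stated range there are $a,b$ (respectively $c$) in the stated ranges representing $m$ as displayed, and that the formula for $M_m(C_1,C_2)$ holds for every such representation. 1. *First case: $u_2-q+2\ge0$.* Then $\ell=t(2q-u_2-t-2)+\frac{t(t+1)}2$. - If $1\le m\le t(2q-u_2-t-2)$: $m=at+b$ with $0\le a\le 2(q-1)-u_2-t-1$, $1\le b\le t$, and $M_m(C_1,C_2)=(2q-2-u_2-\frac a2)(a+1)+b-t$. - If $t(2q-u_2-t-2)+1\le m\le \ell$: $m=t(2q-u_2-t-2)+c$ with $1\le c\le\frac{t(t+1)}2$, and $M_m(C_1,C_2)=\frac12(2q-u_2-t-2)(2q-u_2+t-1)+c$. 2. *Second case: $u_2-q+t+1\le0$.* Then $\ell=\frac{t(t+1)}2+t(u_2+1)$. - If $1\le m\le\frac{t(t+1)}2$: $m=\frac{a(a+1)}2+b$ with $0\le a\le t-1$, $1\le b\le a+1$, and $M_m(C_1,C_2)=q(q-u_2-t+a)+b-a-1$. - If $\frac{t(t+1)}2+1\le m\le \ell$: $m=\frac{t(t+1)}2+at+b$ with $0\le a\le u_2$,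 $1\le b\le t$, and $M_m(C_1,C_2)=q(q+a-u_2)+b-t-1-\frac{a(a+3)}2$. 3. *Third case: $u_2-q+2<0$ and $u_2-q+t+1>0$.* Then $\ell=(2q-u_2)(u_2+t)+3(q-u_2)-q^2-2-\frac{t(t+3)}2$. (i) *If $t\le q$*, put $B=\frac12(q-u_2-2)(2t-q+u_2+1)$. - If $1\le m\le B+t$: $m=a(u_2+t-q+1)+\frac{a(a+1)}2+b$ with $0\le a\le q-u_2-2$, $1\le b\le u_2+t-q+a+2$, and $M_m(C_1,C_2)=(a+2)(q-1)-u_2-t+b$. - If $B+t+1\le m\le B+t(q-t)$: $m=B+(a+1)t+b$ with $0\le a\le q-t-2$, $1\le b\le t$, and $M_m(C_1,C_2)=q(q-u_2+a)-\frac{a(a+3)}2-t+b-1$. - If $m\ge1$ and $B+t(q-t)+1\le m\le\ell$: $m=B+t(q-t)+c$ with $1\le c\le\frac12\big((t+1)^2-(q-u_2-1)^2+q-u_2-t-2\big)$, and $M_m(C_1,C_2)=\frac12(3q^2-2u_2q-3q-t^2-t)+c$. (ii) *If $t>q$*, put $u=u_2+t$. - If $1\le m\le q(u+2)-\frac{u(u+3)}2-1$: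 $m=a(u-q+1)+\frac{a(a+1)}2+b$ with $0\le a\le 2(q-1)-u$, $1\le b\le u-q+2+a$, and $M_m(C_1,C_2)=(a+2)(q-1)-u+b$. - If $q(u+2)-\frac{u(u+3)}2\le m\le\ell$: $m=q(u+2)-\frac{u(u+3)}2-1+c$ with $c\ge1$, and $M_m(C_1,C_2)=q(2q-u-1)+c$. **Generalized Hamming weights** (the case $u_2=-1$). Let $0\le u\le2(q-1)$ and $C_1=RM_q(u,2)$; the same convention applies. 4. *If $u-q+1\le0$:* $\dim C_1=\frac{(u+1)(u+2)}2$. If $1\le r\le\dim C_1$: $r=\frac{a(a+1)}2+b$ with $0\le a\le u$, $1\le b\le a+1$, and $d_r(C_1)=q(q-u+a)+b-a-1$. 5. *If $u-q+1>0$:* $\dim C_1=q(2u-q+3)-\frac{u(u+3)}2-1$. - If $1\le r\le q(u+2)-\frac{u(u+3)}2-1$: $r=a(u-q+1)+\frac{a(a+1)}2+b$ with $0\le a\le2(q-1)-u$, $1\le b\le u-q+2+a$, and $d_r(C_1)=(a+2)(q-1)-u+b$. - If $q(u+2)-\frac{u(u+3)}2\le r\le\dim C_1$: $r=q(u+2)-\frac{u(u+3)}2-1+c$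 with $1\le c\le q(u-q+1)$, and $d_r(C_1)=q(2q-u-1)+c$. -/

import Mathlib

/-- The `q`-ary Reed-Muller code `RM_q(u,s)` over the finite field `F` with `q` elements.  Words are
indexed by the `n = q^s` points of `F^s` themselves.  The zero polynomial is always allowed
(it has degree `-1`, so that `RM_q(-1,s)` is the zero code). -/
def reedMuller (F : Type*) [Field F] (u : ℤ) (s : ℕ) : Submodule F ((Fin s → F) → F) where
  carrier := {c | ∃ f : MvPolynomial (Fin s) F,
    (f = 0 ∨ (f.totalDegree : ℤ) ≤ u) ∧ c = fun P => MvPolynomial.eval P f}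
  zero_mem' := ⟨0, Or.inl rfl, by funext P; simp⟩
  add_mem' := by
    rintro c d ⟨f, hf, rfl⟩ ⟨g, hg, rfl⟩
    refine ⟨f + g, ?_, by funext P; simp⟩
    rcases hf with rfl | hf
    · simpa using hg
    · rcases hg with rfl | hg
      · right; simpa using hf
      · right
        have := MvPolynomial.totalDegree_add f g
        omega
  smul_mem' := by
    rintro k c ⟨f, hf, rfl⟩
    refine ⟨k • f, ?_, by funext P; simp [MvPolynomial.smul_eval]⟩
    rcases hf with rfl | hf
    · left; simp
    · right
      have := MvPolynomial.totalDegree_smul_le k f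
      omega

/-- `C_J`: the subcode of the words of `C` that vanish at every position outside `J`. -/
def subcodeOn {F ι : Type*} [Field F] (C : Submodule F (ι → F)) (J : Finset ι) :
    Submodule F (ι → F) where
  carrier := {c | c ∈ C ∧ ∀ i, i ∉ J → c i = 0}
  zero_mem' := ⟨C.zero_mem, fun _ _ => rfl⟩
  add_mem' := fun {c d} hc hd =>
    ⟨C.add_mem hc.1 hd.1, fun i hi => by simp [hc.2 i hi, hd.2 i hi]⟩
  smul_mem' := fun k {c} hc => ⟨C.smul_mem k hc.1, fun i hi => by simp [hc.2 i hi]⟩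

/-- The `m`-th relative generalized Hamming weight
`M_m(C₁,C₂) = min {|J| : dim (C₁)_J - dim (C₂)_J = m}`.
(The infimum of the empty set would be `0`; so a positive value is always attained.) -/
noncomputable def rghw {F ι : Type*} [Field F] (C₁ C₂ : Submodule F (ι → F)) (m : ℕ) : ℕ :=
  sInf {k : ℕ | ∃ J : Finset ι, J.card = k ∧
    (Module.finrank F (subcodeOn C₁ J) : ℤ) - Module.finrank F (subcodeOn C₂ J) = m}

/-- The support of a linear code: the positions at which some word is nonzero. -/
def codeSupp {F ι : Type*} [Field F] (D : Submodule F (ι → F)) : Set ι :=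
  {i | ∃ c ∈ D, c i ≠ 0}

/-- The `r`-th generalized Hamming weight
`d_r(C) = min {|supp D| : D a linear subcode of C, dim D = r}`.
(The infimum of the empty set would be `0`; so a positive value is always attained.) -/
noncomputable def ghw {F ι : Type*} [Field F] (C : Submodule F (ι → F)) (r : ℕ) : ℕ :=
  sInf {k : ℕ | ∃ D : Submodule F (ι → F),
    D ≤ C ∧ Module.finrank F D = r ∧ (codeSupp D).ncard = k}

open Finset

/-! Both kinds of weights reduce to one counting problem about staircases in a `q × q` box.

Expand words on `F²` in the Newton basis `∏_{k<i}(x - α_k) ∏_{k<j}(y - α_k)`, `i, j < q`, ordered by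
degree with ties broken by `i`. A Reed-Muller code is then spanned by an initial segment of the
basis, so the dimension of its subcode on `J` is the number of leading indices, of words supported
on `J`, that have degree at most `u`. Multiplying by `x` or `y` preserves supports, so these leading
indices are closed upwards. Reversing both coordinates gives a lower set `coFootprint J` with `|J|`
points, in which degree at most `u` becomes `i + j ≥ 2(q-1) - u`. Conversely, every lower set of the
box arises from some `J` (`exists_coFootprint_eq`).

Hence a relative weight is the least size of a lower set with `m` points in a band `α ≤ i + j < β`.
Filling columns one after another is optimal (`le_card_of_le_band`, `exists_band_eq`): a lower set
with too few points below the band has a deficient diagonal there, and the deficiency persists on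
all later diagonals, leaving too few points in the band. If `A` full columns have fewer than `m`
band points and `A + 1` have at least `m`, the minimum is `m` plus the points of `A + 1` columns
below the band.

Ordinary weights are the instance whose band reaches past the top of the box. The case distinctions
only record how the two band boundaries sit relative to the long diagonal, which decides the closed
form of `columnSum`. -/

/-! ### Lower sets of a box, counted along diagonals. -/

/-- Number of points of `X` on the diagonal `i + j = s`. -/
def diagCount (X : Finset (ℕ × ℕ)) (s : ℕ) : ℕ := #{p ∈ X | p.1 + p.2 = s}

/-- Number of points of `X` below the diagonal `i + j = s`. -/
def belowCount (X : Finset (ℕ × ℕ)) (s : ℕ) : ℕ := #{p ∈ X | p.1 + p.2 < s}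

/-- Number of points `(i, j)` with `i < a`, `j < q` and `i + j < s`. -/
def columnSum (q s a : ℕ) : ℕ := ∑ i ∈ range a, min q (s - i)

lemma belowCount_succ (X : Finset (ℕ × ℕ)) (s : ℕ) :
    belowCount X (s + 1) = belowCount X s + diagCount X s := by
  unfold belowCount diagCount
  rw [← card_union_of_disjoint]
  · congr 1
    ext p
    simp only [mem_filter, mem_union]
    constructor
    · rintro ⟨h, h'⟩
      rcases Nat.lt_succ_iff_lt_or_eq.mp h' with h'' | h''
      · exact Or.inl ⟨h, h''⟩
      · exact Or.inr ⟨h, h''⟩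
    · rintro (⟨h, h'⟩ | ⟨h, h'⟩)
      · exact ⟨h, by omega⟩
      · exact ⟨h, by omega⟩
  · rw [disjoint_filter]
    intro p _ h
    omega

lemma belowCount_eq_sum (X : Finset (ℕ × ℕ)) (s : ℕ) :
    belowCount X s = ∑ k ∈ range s, diagCount X k := by
  induction s with
  | zero => simp [belowCount]
  | succ s ih => rw [belowCount_succ, sum_range_succ, ih]

lemma belowCount_le_card (X : Finset (ℕ × ℕ)) (s : ℕ) : belowCount X s ≤ #X :=
  card_filter_le _ _

/-- The points under the graph of `f`, over `i < n`, in the box of height `q`. -/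
def underGraph (q n : ℕ) (f : ℕ → ℕ) : Finset (ℕ × ℕ) :=
  (range n ×ˢ range q).filter fun p => p.2 < f p.1

lemma belowCount_underGraph (q n s : ℕ) (f : ℕ → ℕ) :
    belowCount (underGraph q n f) s = ∑ i ∈ range n, min (min q (f i)) (s - i) := by
  have h : {p ∈ underGraph q n f | p.1 + p.2 < s} =
      ((range n).sigma fun i => range (min (min q (f i)) (s - i))).map
        (Equiv.sigmaEquivProd ℕ ℕ).toEmbedding := by
    ext ⟨i, j⟩
    simp only [underGraph, mem_filter, mem_product, mem_range, mem_map, mem_sigma,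
      Equiv.coe_toEmbedding, Equiv.sigmaEquivProd_apply, Sigma.exists, Prod.mk.injEq]
    constructor
    · rintro ⟨⟨⟨h1, h2⟩, h3⟩, h4⟩
      exact ⟨i, j, ⟨h1, by omega⟩, rfl, rfl⟩
    · rintro ⟨i', j', ⟨h1, h2⟩, rfl, rfl⟩
      exact ⟨⟨⟨h1, by omega⟩, by omega⟩, by omega⟩
  rw [belowCount, h, card_map, card_sigma]
  simp

lemma card_underGraph (q n : ℕ) (f : ℕ → ℕ) :
    #(underGraph q n f) = ∑ i ∈ range n, min q (f i) := by
  have h : belowCount (underGraph q n f) (n + q) = #(underGraph q n f) := by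
    rw [belowCount, filter_true_of_mem]
    intro p hp
    simp only [underGraph, mem_filter, mem_product, mem_range] at hp
    omega
  rw [← h, belowCount_underGraph]
  apply sum_congr rfl
  intro i hi
  rw [mem_range] at hi
  omega

lemma diagCount_columns {q a s : ℕ} :
    diagCount (range a ×ˢ range q) s = min a (s + 1) - (s + 1 - q) := by
  rw [← Nat.card_Ico, diagCount]
  refine card_bij (fun p _ => p.1) ?_ ?_ ?_
  · rintro ⟨i, j⟩ h
    simp only [mem_filter, mem_product, mem_range, mem_Ico] at h ⊢
    omega
  · rintro ⟨i, j⟩ h ⟨i', j'⟩ h' e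
    simp only [mem_filter, mem_product, mem_range, Prod.mk.injEq] at h h' e ⊢
    omega
  · intro i h
    simp only [mem_Ico] at h
    refine ⟨(i, s - i), ?_, rfl⟩
    simp only [mem_filter, mem_product, mem_range]
    omega

lemma belowCount_columns (q a s : ℕ) :
    belowCount (range a ×ˢ range q) s = columnSum q s a := by
  have h : range a ×ˢ range q = underGraph q a fun _ => q := by
    ext p
    simp only [underGraph, mem_filter, mem_product, mem_range]
    tauto
  rw [h, belowCount_underGraph, columnSum]
  simp

/-- A gap `(x, s - x)` excludes its two upper neighbours from the next diagonal. The points there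
with abscissa below `x` move down, those beyond `x + 1` move left, and the two images stay on
opposite sides of the gap. -/
lemma diagCount_succ_le {X : Finset (ℕ × ℕ)} (hX : IsLowerSet (X : Set (ℕ × ℕ))) {s : ℕ}
    (h : diagCount X s < s + 1) : diagCount X (s + 1) ≤ diagCount X s := by
  obtain ⟨x, hx, hxX⟩ : ∃ x ≤ s, (x, s - x) ∉ X := by
    by_contra! hc
    have : (range (s + 1)).card ≤ diagCount X s := by
      refine card_le_card_of_injOn (fun i => (i, s - i)) ?_ ?_
      · intro i hi
        simp only [coe_range, Set.mem_Iio] at hi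
        simp only [coe_filter, Set.mem_ofPred_eq]
        exact ⟨hc i (by omega), by omega⟩
      · intro i _ j _ e
        exact (Prod.mk.inj e).1
    rw [card_range] at this
    omega
  have key : ∀ i j, (i, j) ∈ X → i + j = s + 1 → i < x ∨ x + 1 < i := by
    intro i j hij e
    by_contra hc
    refine hxX (hX (a := (i, j)) ⟨?_, ?_⟩ hij)
    · simp only; omega
    · simp only; omega
  refine card_le_card_of_injOn (fun p => if p.1 < x then (p.1, p.2 - 1) else (p.1 - 1, p.2)) ?_ ?_
  · rintro ⟨i, j⟩ hp
    simp only [coe_filter, Set.mem_ofPred_eq] at hp ⊢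
    have := key i j hp.1 hp.2
    split_ifs with hi
    · exact ⟨hX (a := (i, j)) ⟨le_refl i, Nat.sub_le j 1⟩ hp.1, by simp only; omega⟩
    · exact ⟨hX (a := (i, j)) ⟨Nat.sub_le i 1, le_refl j⟩ hp.1, by simp only; omega⟩
  · rintro ⟨i, j⟩ hp ⟨i', j'⟩ hp' e
    simp only [coe_filter, Set.mem_ofPred_eq] at hp hp' e
    have h1 := key i j hp.1 hp.2
    have h2 := key i' j' hp'.1 hp'.2
    split_ifs at e <;> simp only [Prod.mk.injEq] at e ⊢ <;> omega

/-- From `s + 1 ≥ q` on, a diagonal meets neither axis inside the box. All its points can therefore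
move down, and the leftmost one can also move left, which yields one extra point on the previous
diagonal. -/
lemma diagCount_succ_le_pred {X : Finset (ℕ × ℕ)} (hX : IsLowerSet (X : Set (ℕ × ℕ))) {q s : ℕ}
    (hq : X ⊆ range q ×ˢ range q) (h : q ≤ s + 1) :
    diagCount X (s + 1) ≤ diagCount X s - 1 := by
  rcases Nat.eq_zero_or_pos (diagCount X (s + 1)) with h0 | h0
  · omega
  have box : ∀ i j, (i, j) ∈ X → i < q ∧ j < q := by
    intro i j hij
    simpa using hq hij
  set R := (X.filter fun p => p.1 + p.2 = s + 1).image Prod.fst with hR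
  have hRcard : #R = diagCount X (s + 1) := by
    apply card_image_of_injOn
    rintro ⟨i, j⟩ hp ⟨i', j'⟩ hp' e
    simp only [coe_filter, Set.mem_ofPred_eq, Prod.mk.injEq] at hp hp' e ⊢
    omega
  have hmem : ∀ i, i ∈ R ↔ (i, s + 1 - i) ∈ X ∧ i ≤ s + 1 := by
    intro i
    simp only [hR, mem_image, mem_filter, Prod.exists, exists_and_right, exists_eq_right]
    constructor
    · rintro ⟨j, hj, e⟩
      rw [show s + 1 - i = j by omega]
      exact ⟨hj, by omega⟩
    · rintro ⟨hj, e⟩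
      exact ⟨_, hj, by omega⟩
  have hne : R.Nonempty := by rw [← card_pos, hRcard]; exact h0
  set x := R.min' hne
  have hx := (hmem x).1 (R.min'_mem hne)
  have hxq := box _ _ hx.1
  have hxn : x - 1 ∉ R := by
    intro hc
    have := R.min'_le _ hc
    change x ≤ x - 1 at this
    omega
  have : #(insert (x - 1) R) ≤ diagCount X s := by
    refine card_le_card_of_injOn (fun i => (i, s - i)) ?_ ?_
    · intro i hi
      simp only [coe_insert, Set.mem_insert_iff, mem_coe] at hi
      simp only [coe_filter, Set.mem_ofPred_eq]
      rcases hi with rfl | hi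
      · refine ⟨hX (a := (x, s + 1 - x)) ⟨?_, ?_⟩ hx.1, ?_⟩ <;> omega
      · have hi := (hmem i).1 hi
        have hiq := box _ _ hi.1
        refine ⟨hX (a := (i, s + 1 - i)) ⟨?_, ?_⟩ hi.1, ?_⟩ <;> omega
    · intro i _ j _ e
      exact (Prod.mk.inj e).1
  rw [card_insert_of_notMem hxn, hRcard] at this
  omega

/-- Among lower sets of the `q × q` box with at least `m` points in the band `α ≤ i + j < β`, the
smallest ones fill up whole columns. -/
theorem le_card_of_le_band {X : Finset (ℕ × ℕ)} (hX : IsLowerSet (X : Set (ℕ × ℕ))) {q α β A m : ℕ}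
    (hq : X ⊆ range q ×ˢ range q) (hαβ : α ≤ β) (hA : A < q)
    (h1 : columnSum q β A < m + columnSum q α A)
    (h2 : m + belowCount X α ≤ belowCount X β) :
    m + columnSum q α (A + 1) ≤ #X := by
  suffices h : columnSum q α (A + 1) ≤ belowCount X α by
    have := belowCount_le_card X β
    omega
  by_contra! hc
  rw [← belowCount_columns, belowCount_eq_sum, belowCount_eq_sum] at hc
  -- Some diagonal below the band carries fewer points of `X` than of `A + 1` full columns.
  obtain ⟨s₀, hs₀, hlt⟩ := exists_lt_of_sum_lt hc
  rw [mem_range] at hs₀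
  rw [diagCount_columns] at hlt
  -- The deficiency propagates: an incomplete diagonal is not followed by a longer one, and past the
  -- long diagonal each step loses a point, exactly as `A` full columns do. So the band of `X` is no
  -- richer than that of `A` columns, contradicting `h1`.
  have inv : ∀ s, s₀ ≤ s → diagCount X s ≤ A - (s + 1 - q) ∧ diagCount X s < s + 1 := by
    intro s hs
    induction s, hs using Nat.le_induction with
    | base => omega
    | succ s _ ih =>
      rcases lt_or_ge (s + 1) q with h | h
      · have := diagCount_succ_le hX ih.2
        omega
      · have := diagCount_succ_le_pred hX hq h
        omega
  have hle : ∀ s ∈ Ico α β, diagCount X s ≤ diagCount (range A ×ˢ range q) s := by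
    intro s hs
    rw [mem_Ico] at hs
    have := inv s (by omega)
    rw [diagCount_columns]
    omega
  have hsum := sum_le_sum hle
  have e1 := sum_range_add_sum_Ico (diagCount X) hαβ
  have e2 := sum_range_add_sum_Ico (diagCount (range A ×ˢ range q)) hαβ
  simp only [← belowCount_eq_sum, belowCount_columns] at e1 e2
  omega

/-- The extremal set consists of the first `A` columns cut off at the upper band boundary, and of
part of column `A`. -/
theorem exists_band_eq {q α β A m : ℕ} (hαβ : α ≤ β) (hA : A < q)
    (h1 : columnSum q β A < m + columnSum q α A)
    (h2 : m + columnSum q α (A + 1) ≤ columnSum q β (A + 1)) :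
    ∃ X : Finset (ℕ × ℕ), IsLowerSet (X : Set (ℕ × ℕ)) ∧ X ⊆ range q ×ˢ range q ∧
      #X = m + columnSum q α (A + 1) ∧ m + belowCount X α = belowCount X β := by
  have sβ : columnSum q β (A + 1) = columnSum q β A + min q (β - A) := sum_range_succ _ _
  have sα : columnSum q α (A + 1) = columnSum q α A + min q (α - A) := sum_range_succ _ _
  -- By `h1` and `h2`, `min q (α - A) < h ≤ min q (β - A)`. The last column thus reaches past the
  -- lower band boundary without crossing the upper one, and the heights are nonincreasing.
  set h := m + columnSum q α (A + 1) - columnSum q β A with hh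
  set f : ℕ → ℕ := fun i => if i < A then min q (β - i) else h with hf
  have hfA : f A = h := by simp [hf]
  have hfl : ∀ i ∈ range A, f i = min q (β - i) := by
    intro i hi
    rw [mem_range] at hi
    simp [hf, hi]
  have cnt : ∀ g : ℕ → ℕ → ℕ, ∑ i ∈ range (A + 1), g (f i) i =
      ∑ i ∈ range A, g (min q (β - i)) i + g h A := by
    intro g
    rw [sum_range_succ, hfA]
    congr 1
    exact sum_congr rfl fun i hi => by rw [hfl i hi]
  have hcard : #(underGraph q (A + 1) f) = columnSum q β A + h := by
    rw [card_underGraph, cnt fun x _ => min q x, columnSum]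
    congr 1
    · exact sum_congr rfl fun i _ => by omega
    · omega
  have hβ : belowCount (underGraph q (A + 1) f) β = columnSum q β A + h := by
    rw [belowCount_underGraph, cnt fun x i => min (min q x) (β - i), columnSum]
    congr 1
    · exact sum_congr rfl fun i _ => by omega
    · omega
  have hα : belowCount (underGraph q (A + 1) f) α = columnSum q α (A + 1) := by
    rw [belowCount_underGraph, cnt fun x i => min (min q x) (α - i), sα, columnSum]
    congr 1
    · exact sum_congr rfl fun i _ => by omega
    · omega
  refine ⟨underGraph q (A + 1) f, ?_, ?_, by omega, by omega⟩
  · rintro ⟨i, j⟩ ⟨i', j'⟩ hle hm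
    have h1 : i' ≤ i := hle.1
    have h2 : j' ≤ j := hle.2
    simp only [underGraph, coe_filter, mem_product, mem_range, Set.mem_ofPred_eq] at hm ⊢
    refine ⟨by omega, lt_of_le_of_lt h2 (lt_of_lt_of_le hm.2 ?_)⟩
    simp only [hf]
    split_ifs <;> omega
  · intro p hp
    simp only [underGraph, mem_filter, mem_product, mem_range] at hp ⊢
    omega

/-! ### Leading indices of a subspace with respect to an ordered basis. -/

section LeadingIndices

variable {K W ι : Type*} [Field K] [AddCommGroup W] [Module K W]

/-- The vectors all of whose coordinates of key at least `n` vanish. -/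
def lowerPart (b : Module.Basis ι K W) (key : ι → ℕ) (n : ℕ) : Submodule K W where
  carrier := {v | ∀ p, n ≤ key p → b.repr v p = 0}
  zero_mem' := by simp
  add_mem' := fun {v w} hv hw p hp => by simp [hv p hp, hw p hp]
  smul_mem' := fun c v hv p hp => by simp [hv p hp]

lemma mem_lowerPart {b : Module.Basis ι K W} {key : ι → ℕ} {n : ℕ} {v : W} :
    v ∈ lowerPart b key n ↔ ∀ p, n ≤ key p → b.repr v p = 0 := Iff.rfl

/-- The leading indices of the vectors of `V`, with respect to a basis ordered by `key`. -/
def leadingIndices (b : Module.Basis ι K W) (key : ι → ℕ) (V : Submodule K W) : Set ι :=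
  {p | ∃ v ∈ V, v ∈ lowerPart b key (key p + 1) ∧ b.repr v p ≠ 0}

variable {b : Module.Basis ι K W} {key : ι → ℕ} {V : Submodule K W}

-- Raising the bound by one admits at most one new coordinate. It raises the dimension precisely
-- when that coordinate functional is nonzero on the larger space, that is, when its index is
-- leading.
open Classical in
theorem finrank_inf_lowerPart [Fintype ι] (hkey : Function.Injective key) (n : ℕ) :
    Module.finrank K (V ⊓ lowerPart b key n : Submodule K W) =
      #{p | key p < n ∧ p ∈ leadingIndices b key V} := by
  have : FiniteDimensional K W := b.finiteDimensional_of_finite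
  induction n with
  | zero =>
    have : lowerPart b key 0 = ⊥ := by
      rw [eq_bot_iff]
      intro v hv
      rw [Submodule.mem_bot, ← b.repr.map_eq_zero_iff]
      ext p
      exact hv p (Nat.zero_le _)
    simp [this]
  | succ n ih =>
    by_cases hp : ∃ p, key p = n ∧ p ∈ leadingIndices b key V
    · obtain ⟨p, rfl, hpV⟩ := hp
      have hcard : #{p' | key p' < key p + 1 ∧ p' ∈ leadingIndices b key V} =
          #{p' | key p' < key p ∧ p' ∈ leadingIndices b key V} + 1 := by
        rw [← card_insert_of_notMem (a := p) (by simp)]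
        congr 1
        ext p'
        simp only [mem_filter, mem_univ, true_and, mem_insert, Nat.lt_succ_iff_lt_or_eq]
        constructor
        · rintro ⟨h | h, h'⟩
          · exact Or.inr ⟨h, h'⟩
          · exact Or.inl (hkey h)
        · rintro (rfl | h)
          · exact ⟨Or.inr rfl, hpV⟩
          · exact ⟨Or.inl h.1, h.2⟩
      rw [hcard, ← ih]
      set φ : (V ⊓ lowerPart b key (key p + 1) : Submodule K W) →ₗ[K] K :=
        (b.coord p).comp (Submodule.subtype _) with hφ
      have hφ0 : φ ≠ 0 := by
        obtain ⟨v, hv, hv', hvp⟩ := hpV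
        intro h0
        exact hvp (LinearMap.congr_fun h0 ⟨v, hv, hv'⟩)
      have hinj : Function.Injective ((Submodule.subtype
          (V ⊓ lowerPart b key (key p + 1))).comp (LinearMap.ker φ).subtype) := by
        rw [LinearMap.coe_comp]
        exact (Submodule.subtype_injective _).comp (Submodule.subtype_injective _)
      have hrange : LinearMap.range ((Submodule.subtype
          (V ⊓ lowerPart b key (key p + 1))).comp (LinearMap.ker φ).subtype) =
          V ⊓ lowerPart b key (key p) := by
        ext v
        simp only [LinearMap.mem_range, LinearMap.comp_apply, Submodule.subtype_apply]
        constructor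
        · rintro ⟨⟨⟨v, hv, hv'⟩, hk⟩, rfl⟩
          refine ⟨hv, fun p' hp' => ?_⟩
          rcases eq_or_lt_of_le hp' with h | h
          · rw [← hkey h]
            exact hk
          · exact hv' p' h
        · rintro ⟨hv, hv'⟩
          exact ⟨⟨⟨v, hv, fun p' hp' => hv' p' (by omega)⟩, hv' p le_rfl⟩, rfl⟩
      rw [← hrange, LinearMap.finrank_range_of_inj hinj,
        Module.Dual.finrank_ker_add_one_of_ne_zero hφ0]
    · push Not at hp
      have h1 : V ⊓ lowerPart b key (n + 1) = V ⊓ lowerPart b key n := by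
        ext v
        refine ⟨fun ⟨hv, hv'⟩ => ⟨hv, fun p hpn => ?_⟩,
          fun ⟨hv, hv'⟩ => ⟨hv, fun p hpn => hv' p (by omega)⟩⟩
        rcases eq_or_lt_of_le hpn with h | h
        · subst h
          by_contra h0
          exact hp p rfl ⟨v, hv, hv', h0⟩
        · exact hv' p h
      rw [h1, ih]
      congr 1
      ext p
      simp only [mem_filter, mem_univ, true_and, Nat.lt_succ_iff_lt_or_eq]
      constructor
      · exact fun h => ⟨Or.inl h.1, h.2⟩
      · rintro ⟨h | h, h'⟩
        · exact ⟨h, h'⟩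
        · exact absurd h' (hp p h)

/-- If `M` raises keys by at most `d`, then the coefficient of `M v` at key `key p + d` can only
come from the leading term of `v`, so it does not cancel. -/
theorem mem_leadingIndices_of_map [Fintype ι] (hkey : Function.Injective key) {M : W →ₗ[K] W}
    (hMV : ∀ v ∈ V, M v ∈ V) {d : ℕ} (hM : ∀ p, M (b p) ∈ lowerPart b key (key p + d + 1))
    {p p' : ι} (hp' : key p' = key p + d) (h : b.repr (M (b p)) p' ≠ 0)
    (hp : p ∈ leadingIndices b key V) : p' ∈ leadingIndices b key V := by
  obtain ⟨v, hv, hlow, hvp⟩ := hp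
  have expand : ∀ r, b.repr (M v) r = ∑ s, b.repr v s * b.repr (M (b s)) r := by
    intro r
    have := congrArg (fun w => b.repr (M w) r) (b.sum_repr v).symm
    simpa only [map_sum, map_smul, Finsupp.finsetSum_apply, Finsupp.smul_apply,
      smul_eq_mul] using this
  refine ⟨M v, hMV v hv, fun r hr => ?_, ?_⟩
  · rw [expand]
    refine sum_eq_zero fun s _ => ?_
    by_cases hs : key p + 1 ≤ key s
    · rw [hlow s hs, zero_mul]
    · rw [hM s r (by omega), mul_zero]
  · rw [expand, sum_eq_single p]
    · exact mul_ne_zero hvp h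
    · intro s _ hsp
      rcases lt_trichotomy (key s) (key p) with hs | hs | hs
      · rw [hM s p' (by omega), mul_zero]
      · exact absurd (hkey hs) hsp
      · rw [hlow s hs, zero_mul]
    · simp

end LeadingIndices

/-! ### The Newton basis of the words on the plane. -/

section Newton

variable {F : Type*} [Field F] [Fintype F]

/-- An enumeration of the elements of `F` by the numbers below its cardinality. -/
noncomputable def enumField (F : Type*) [Field F] [Fintype F] (k : ℕ) : F :=
  if h : k < Fintype.card F then (Fintype.equivFin F).symm ⟨k, h⟩ else 0

lemma enumField_injOn {k l : ℕ} (hk : k < Fintype.card F) (hl : l < Fintype.card F)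
    (h : enumField F k = enumField F l) : k = l := by
  simpa [enumField, hk, hl] using h

lemma exists_enumField (x : F) : ∃ k < Fintype.card F, enumField F k = x :=
  ⟨Fintype.equivFin F x, (Fintype.equivFin F x).2, by simp [enumField]⟩

/-- The word `∏_{k < i} (x - α_k) ∏_{k < j} (y - α_k)`. -/
noncomputable def newtonWord (F : Type*) [Field F] [Fintype F] (p : ℕ × ℕ) : (Fin 2 → F) → F :=
  fun P => (∏ k ∈ range p.1, (P 0 - enumField F k)) * ∏ k ∈ range p.2, (P 1 - enumField F k)

lemma prod_card_sub_enumField (x : F) : ∏ k ∈ range (Fintype.card F), (x - enumField F k) = 0 := by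
  obtain ⟨k, hk, rfl⟩ := exists_enumField x
  exact prod_eq_zero (mem_range.2 hk) (sub_self _)

lemma newtonWord_card_left (j : ℕ) : newtonWord F (Fintype.card F, j) = 0 := by
  funext P
  simp [newtonWord, prod_card_sub_enumField]

lemma newtonWord_card_right (i : ℕ) : newtonWord F (i, Fintype.card F) = 0 := by
  funext P
  simp [newtonWord, prod_card_sub_enumField]

/-- Multiplication of words by a coordinate function. -/
def mulCoord (F : Type*) [Field F] (e : Fin 2) : ((Fin 2 → F) → F) →ₗ[F] ((Fin 2 → F) → F) where
  toFun c := fun P => P e * c P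
  map_add' c d := by funext P; simp [mul_add]
  map_smul' k c := by funext P; simp [mul_left_comm]

lemma mulCoord_zero_newtonWord (i j : ℕ) : mulCoord F 0 (newtonWord F (i, j)) =
    newtonWord F (i + 1, j) + enumField F i • newtonWord F (i, j) := by
  funext P
  simp only [mulCoord, newtonWord, LinearMap.coe_mk, AddHom.coe_mk, prod_range_succ, Pi.add_apply,
    Pi.smul_apply, smul_eq_mul]
  ring

lemma mulCoord_one_newtonWord (i j : ℕ) : mulCoord F 1 (newtonWord F (i, j)) =
    newtonWord F (i, j + 1) + enumField F j • newtonWord F (i, j) := by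
  funext P
  simp only [mulCoord, newtonWord, LinearMap.coe_mk, AddHom.coe_mk, prod_range_succ, Pi.add_apply,
    Pi.smul_apply, smul_eq_mul]
  ring

/-- The span of the Newton words of degree at most `d`. -/
noncomputable def newtonSpan (F : Type*) [Field F] [Fintype F] (d : ℕ) :
    Submodule F ((Fin 2 → F) → F) :=
  Submodule.span F ((fun p : Fin (Fintype.card F) × Fin (Fintype.card F) =>
    newtonWord F (p.1, p.2)) '' {p | (p.1 : ℕ) + p.2 ≤ d})

lemma newtonSpan_mono {d e : ℕ} (h : d ≤ e) : newtonSpan F d ≤ newtonSpan F e :=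
  Submodule.span_mono (Set.image_mono fun _ hp => le_trans hp h)

lemma newtonWord_mem_newtonSpan {i j d : ℕ} (hi : i ≤ Fintype.card F) (hj : j ≤ Fintype.card F)
    (hd : i + j ≤ d) : newtonWord F (i, j) ∈ newtonSpan F d := by
  rcases eq_or_lt_of_le hi with rfl | hi
  · rw [newtonWord_card_left]
    exact Submodule.zero_mem _
  rcases eq_or_lt_of_le hj with rfl | hj
  · rw [newtonWord_card_right]
    exact Submodule.zero_mem _
  exact Submodule.subset_span ⟨(⟨i, hi⟩, ⟨j, hj⟩), hd, rfl⟩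

lemma mulCoord_mem_newtonSpan {d : ℕ} (e : Fin 2) {c : (Fin 2 → F) → F} (hc : c ∈ newtonSpan F d) :
    mulCoord F e c ∈ newtonSpan F (d + 1) := by
  suffices h : newtonSpan F d ≤ (newtonSpan F (d + 1)).comap (mulCoord F e) from h hc
  refine Submodule.span_le.2 ?_
  rintro _ ⟨⟨i, j⟩, hp, rfl⟩
  replace hp : (i : ℕ) + j ≤ d := hp
  have h0 := newtonWord_mem_newtonSpan (F := F) i.2.le j.2.le (hp.trans (Nat.le_succ d))
  fin_cases e
  · refine Set.mem_preimage.2 ?_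
    change mulCoord F 0 _ ∈ newtonSpan F (d + 1)
    rw [mulCoord_zero_newtonWord]
    exact Submodule.add_mem _ (newtonWord_mem_newtonSpan i.2 j.2.le (by dsimp only; omega))
      (Submodule.smul_mem _ _ h0)
  · refine Set.mem_preimage.2 ?_
    change mulCoord F 1 _ ∈ newtonSpan F (d + 1)
    rw [mulCoord_one_newtonWord]
    exact Submodule.add_mem _ (newtonWord_mem_newtonSpan i.2.le j.2 (by dsimp only; omega))
      (Submodule.smul_mem _ _ h0)

lemma monomial_mem_newtonSpan (s : Fin 2 →₀ ℕ) (a : F) :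
    (fun P => MvPolynomial.eval P (MvPolynomial.monomial s a)) ∈ newtonSpan F (s 0 + s 1) := by
  have h : ∀ i j : ℕ, (fun P : Fin 2 → F => P 0 ^ i * P 1 ^ j) ∈ newtonSpan F (i + j) := by
    intro i
    induction i with
    | zero =>
      intro j
      induction j with
      | zero =>
        convert newtonWord_mem_newtonSpan (F := F) (Nat.zero_le _) (Nat.zero_le _) le_rfl using 1
        funext P
        simp [newtonWord]
      | succ j ih =>
        rw [← add_assoc]
        convert mulCoord_mem_newtonSpan 1 ih using 1
        funext P
        simp [mulCoord, pow_succ']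
    | succ i ih =>
      intro j
      rw [Nat.add_right_comm]
      convert mulCoord_mem_newtonSpan 0 (ih j) using 1
      funext P
      simp only [mulCoord, LinearMap.coe_mk, AddHom.coe_mk]
      ring
  convert Submodule.smul_mem _ a (h (s 0) (s 1)) using 1
  funext P
  simp [MvPolynomial.eval_monomial, Finsupp.prod_fintype]

lemma eval_mem_newtonSpan (f : MvPolynomial (Fin 2) F) {d : ℕ} (hf : f.totalDegree ≤ d) :
    (fun P => MvPolynomial.eval P f) ∈ newtonSpan F d := by
  have h : (fun P => MvPolynomial.eval P f) = ∑ s ∈ f.support,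
      fun P => MvPolynomial.eval P (MvPolynomial.monomial s (f.coeff s)) := by
    funext P
    rw [Finset.sum_apply, ← map_sum, ← f.as_sum]
  rw [h]
  refine Submodule.sum_mem _ fun s hs => newtonSpan_mono ?_ (monomial_mem_newtonSpan s _)
  refine le_trans ?_ ((MvPolynomial.le_totalDegree hs).trans hf)
  simp [Finsupp.sum_fintype]

lemma exists_eval_eq_newtonWord (p : ℕ × ℕ) : ∃ f : MvPolynomial (Fin 2) F,
    f.totalDegree ≤ p.1 + p.2 ∧ newtonWord F p = fun P => MvPolynomial.eval P f := by
  have h : ∀ (e : Fin 2) (i : ℕ), (∏ k ∈ range i,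
      (MvPolynomial.X e - MvPolynomial.C (enumField F k))).totalDegree ≤ i := by
    intro e i
    refine (MvPolynomial.totalDegree_finsetProd _ _).trans ?_
    refine (sum_le_card_nsmul _ _ 1 fun k _ => ?_).trans (by simp)
    exact (MvPolynomial.totalDegree_sub_C_le _ _).trans (by simp)
  refine ⟨(∏ k ∈ range p.1, (MvPolynomial.X 0 - MvPolynomial.C (enumField F k))) *
    ∏ k ∈ range p.2, (MvPolynomial.X 1 - MvPolynomial.C (enumField F k)), ?_, ?_⟩
  · exact (MvPolynomial.totalDegree_mul _ _).trans (add_le_add (h 0 _) (h 1 _))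
  · funext P
    simp [newtonWord]

lemma top_le_span_newtonWord : ⊤ ≤ Submodule.span F (Set.range
    fun p : Fin (Fintype.card F) × Fin (Fintype.card F) => newtonWord F (p.1, p.2)) := by
  classical
  intro c _
  have hc : c ∈ (MvPolynomial.restrictDegree (Fin 2) F (Fintype.card F - 1)).map
      (MvPolynomial.evalₗ F (Fin 2)) := by
    rw [MvPolynomial.map_restrict_dom_evalₗ]
    trivial
  obtain ⟨f, -, rfl⟩ := hc
  exact Submodule.span_mono (Set.image_subset_range _ _) (eval_mem_newtonSpan f le_rfl)

/-- The basis of Newton words of the space of all words. -/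
noncomputable def newtonBasis (F : Type*) [Field F] [Fintype F] :
    Module.Basis (Fin (Fintype.card F) × Fin (Fintype.card F)) F ((Fin 2 → F) → F) :=
  basisOfTopLeSpanOfCardEqFinrank (fun p => newtonWord F (p.1, p.2)) top_le_span_newtonWord (by
    classical
    simp [sq])

lemma newtonBasis_apply (p : Fin (Fintype.card F) × Fin (Fintype.card F)) :
    newtonBasis F p = newtonWord F (p.1, p.2) := by
  simp [newtonBasis]

/-- The graded order on the indices of the Newton basis, as a rank function. -/
def gradedKey {n : ℕ} (p : Fin n × Fin n) : ℕ := (p.1 + p.2) * n + p.1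

/-- The summand `p.1 < n` only breaks ties, so cutting the key at a multiple of `n` is cutting the
degree. -/
lemma gradedKey_lt_iff {n : ℕ} (p : Fin n × Fin n) (d : ℕ) :
    gradedKey p < (d + 1) * n ↔ (p.1 : ℕ) + p.2 ≤ d := by
  unfold gradedKey
  have := p.1.2
  constructor
  · intro h
    by_contra! hc
    have : (d + 1) * n ≤ (p.1 + p.2) * n := Nat.mul_le_mul_right n hc
    omega
  · intro h
    have : ((p.1 : ℕ) + p.2 + 1) * n ≤ (d + 1) * n := Nat.mul_le_mul_right n (by omega)
    rw [add_mul _ 1, one_mul] at this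
    omega

lemma gradedKey_injective {n : ℕ} : Function.Injective (gradedKey (n := n)) := by
  intro p p' h
  have h1 := (gradedKey_lt_iff p (p'.1 + p'.2)).1 (h ▸ (gradedKey_lt_iff p' _).2 le_rfl)
  have h2 := (gradedKey_lt_iff p' (p.1 + p.2)).1 (h ▸ (gradedKey_lt_iff p _).2 le_rfl)
  have h3 : (p.1 : ℕ) + p.2 = p'.1 + p'.2 := le_antisymm h1 h2
  simp only [gradedKey, h3] at h
  ext <;> omega

end Newton

/-! ### Subcodes supported on a set of positions. -/

section Subcode

variable {F : Type*} [Field F]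

lemma subcodeOn_eq_inf {ι : Type*} (C : Submodule F (ι → F)) (J : Finset ι) :
    subcodeOn C J = subcodeOn ⊤ J ⊓ C := by
  ext c
  exact ⟨fun h => ⟨⟨trivial, h.2⟩, h.1⟩, fun h => ⟨h.2, h.1.2⟩⟩

lemma finrank_subcodeOn_top {ι : Type*} [Fintype ι] (J : Finset ι) :
    Module.finrank F (subcodeOn (⊤ : Submodule F (ι → F)) J) = #J := by
  classical
  have h : subcodeOn (⊤ : Submodule F (ι → F)) J =
      ⨅ i ∈ (Jᶜ : Finset ι), LinearMap.ker (LinearMap.proj i : (ι → F) →ₗ[F] F) := by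
    ext c
    simp [subcodeOn, Submodule.mem_iInf]
  have e := LinearMap.iInfKerProjEquiv F (fun _ : ι => F) (I := (J : Set ι))
    (J := ((Jᶜ : Finset ι) : Set ι)) (by simpa using disjoint_compl_right) (by simp)
  rw [h]
  refine e.finrank_eq.trans ?_
  simp

lemma mulCoord_mem_subcodeOn {J : Finset (Fin 2 → F)} (e : Fin 2) :
    ∀ v ∈ subcodeOn (⊤ : Submodule F ((Fin 2 → F) → F)) J, mulCoord F e v ∈ subcodeOn ⊤ J :=
  fun v hv => ⟨trivial, fun P hP => by simp [mulCoord, hv.2 P hP]⟩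

end Subcode

/-! ### From position sets to lower sets, and back. -/

section Footprint

variable {F : Type*} [Field F] [Fintype F]

lemma newtonSpan_eq_span_newtonBasis (d : ℕ) : newtonSpan F d =
    Submodule.span F (newtonBasis F '' {p | (p.1 : ℕ) + p.2 ≤ d}) := by
  unfold newtonSpan
  congr 1
  exact Set.image_congr fun p _ => (newtonBasis_apply p).symm

lemma mem_reedMuller_iff (u : ℤ) (c : (Fin 2 → F) → F) : c ∈ reedMuller F u 2 ↔
    ∀ p : Fin (Fintype.card F) × Fin (Fintype.card F), u < ((p.1 : ℕ) : ℤ) + (p.2 : ℕ) →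
      (newtonBasis F).repr c p = 0 := by
  constructor
  · rintro ⟨f, hf, rfl⟩ p hp
    rcases hf with rfl | hf
    · have : (fun P => MvPolynomial.eval P (0 : MvPolynomial (Fin 2) F)) = 0 := by
        funext P
        simp
      rw [this]
      simp
    · have h := eval_mem_newtonSpan f le_rfl
      rw [newtonSpan_eq_span_newtonBasis, Module.Basis.mem_span_image] at h
      by_contra h0
      have : (p.1 : ℕ) + p.2 ≤ f.totalDegree := h (Finsupp.mem_support_iff.2 h0)
      omega
  · intro h
    rw [← (newtonBasis F).sum_repr c]
    refine Submodule.sum_mem _ fun p _ => ?_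
    rcases lt_or_ge u (((p.1 : ℕ) : ℤ) + (p.2 : ℕ)) with hp | hp
    · simp [h p hp]
    · refine Submodule.smul_mem _ _ ?_
      obtain ⟨f, hf, hf'⟩ := exists_eval_eq_newtonWord (F := F) (p.1, p.2)
      rw [newtonBasis_apply]
      exact ⟨f, Or.inr (by dsimp only at hf; omega), hf'⟩

lemma reedMuller_eq_lowerPart (u : ℤ) : reedMuller F u 2 =
    lowerPart (newtonBasis F) gradedKey ((u + 1).toNat * Fintype.card F) := by
  ext c
  rw [mem_reedMuller_iff, mem_lowerPart]
  refine forall_congr' fun p => imp_congr ?_ Iff.rfl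
  rcases lt_or_ge u 0 with hu | hu
  · rw [show (u + 1).toNat = 0 by omega]
    simp only [zero_mul, Nat.zero_le, iff_true]
    omega
  · rw [show (u + 1).toNat = u.toNat + 1 by omega, ← not_lt (a := gradedKey p), gradedKey_lt_iff]
    omega

open Classical in
/-- The indices `(i, j)`, counted from the top, of the leading terms of the words supported
on `J`. -/
noncomputable def coFootprint (J : Finset (Fin 2 → F)) : Finset (ℕ × ℕ) :=
  (univ.filter fun p : Fin (Fintype.card F) × Fin (Fintype.card F) =>
    p ∈ leadingIndices (newtonBasis F) gradedKey (subcodeOn ⊤ J)).image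
      fun p => ((p.1.rev : ℕ), (p.2.rev : ℕ))

lemma mem_coFootprint {J : Finset (Fin 2 → F)}
    (p : Fin (Fintype.card F) × Fin (Fintype.card F)) :
    ((p.1.rev : ℕ), (p.2.rev : ℕ)) ∈ coFootprint J ↔
      p ∈ leadingIndices (newtonBasis F) gradedKey (subcodeOn ⊤ J) := by
  classical
  simp only [coFootprint, mem_image, mem_filter, mem_univ, true_and, Prod.mk.injEq,
    Fin.val_inj, Fin.rev_inj]
  constructor
  · rintro ⟨p', h, h1, h2⟩
    rwa [show p = p' from Prod.ext h1.symm h2.symm]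
  · exact fun h => ⟨p, h, rfl, rfl⟩

lemma coFootprint_subset (J : Finset (Fin 2 → F)) :
    coFootprint J ⊆ range (Fintype.card F) ×ˢ range (Fintype.card F) := by
  classical
  intro p hp
  simp only [coFootprint, mem_image] at hp
  obtain ⟨p', -, rfl⟩ := hp
  simp only [mem_product, mem_range]
  exact ⟨p'.1.rev.2, p'.2.rev.2⟩

lemma finrank_subcodeOn_reedMuller_eq (J : Finset (Fin 2 → F)) (u : ℤ) :
    Module.finrank F (subcodeOn (reedMuller F u 2) J) =
      #{p ∈ coFootprint J | 2 * ((Fintype.card F : ℤ) - 1) - u ≤ (p.1 : ℤ) + (p.2 : ℤ)} := by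
  classical
  rw [subcodeOn_eq_inf, reedMuller_eq_lowerPart, finrank_inf_lowerPart gradedKey_injective]
  have hu : ∀ p : Fin (Fintype.card F) × Fin (Fintype.card F),
      gradedKey p < (u + 1).toNat * Fintype.card F ↔ ((p.1 : ℕ) : ℤ) + (p.2 : ℕ) ≤ u := by
    intro p
    rcases lt_or_ge u 0 with hu | hu
    · rw [show (u + 1).toNat = 0 by omega]
      simp only [zero_mul, Nat.not_lt_zero, false_iff]
      omega
    · rw [show (u + 1).toNat = u.toNat + 1 by omega, gradedKey_lt_iff]
      omega
  refine card_bij (fun p _ => ((p.1.rev : ℕ), (p.2.rev : ℕ))) ?_ ?_ ?_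
  · intro p hp
    simp only [mem_filter, mem_univ, true_and] at hp ⊢
    have h := (hu p).1 hp.1
    refine ⟨(mem_coFootprint p).2 hp.2, ?_⟩
    rw [Fin.val_rev, Fin.val_rev]
    omega
  · intro p _ p' _ h
    simp only [Prod.mk.injEq, Fin.val_inj, Fin.rev_inj] at h
    exact Prod.ext h.1 h.2
  · intro r hr
    simp only [mem_filter] at hr
    obtain ⟨h1, h2⟩ := hr
    have hbox := coFootprint_subset J h1
    simp only [mem_product, mem_range] at hbox
    have e : r = (((Fin.rev (⟨r.1, hbox.1⟩ : Fin (Fintype.card F))).rev : ℕ),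
        ((Fin.rev (⟨r.2, hbox.2⟩ : Fin (Fintype.card F))).rev : ℕ)) := by simp
    refine ⟨((Fin.rev ⟨r.1, hbox.1⟩), (Fin.rev ⟨r.2, hbox.2⟩)), ?_, e.symm⟩
    simp only [mem_filter, mem_univ, true_and]
    refine ⟨(hu _).2 ?_, (mem_coFootprint _).1 (e ▸ h1)⟩
    simp only [Fin.val_rev]
    omega

lemma reedMuller_eq_top {u : ℤ} (hu : 2 * ((Fintype.card F : ℤ) - 1) ≤ u) :
    reedMuller F u 2 = ⊤ := by
  rw [eq_top_iff]
  intro c _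
  rw [mem_reedMuller_iff]
  intro p hp
  have := p.1.2
  have := p.2.2
  omega

/-- At `u = 2(q-1)` the code is the whole space and the degree condition on indices is void. -/
lemma card_coFootprint (J : Finset (Fin 2 → F)) : #(coFootprint J) = #J := by
  rw [← finrank_subcodeOn_top (F := F) J, ← reedMuller_eq_top (F := F) le_rfl,
    finrank_subcodeOn_reedMuller_eq, filter_true_of_mem]
  intro p _
  omega

/-- The dimension of the words of a Reed-Muller code that are supported on `J`. -/
lemma finrank_subcodeOn_add_belowCount (J : Finset (Fin 2 → F)) {u : ℤ} {α : ℕ}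
    (h : u = 2 * ((Fintype.card F : ℤ) - 1) - α) :
    Module.finrank F (subcodeOn (reedMuller F u 2) J) + belowCount (coFootprint J) α = #J := by
  rw [finrank_subcodeOn_reedMuller_eq, ← card_coFootprint J, belowCount,
    ← card_filter_add_card_filter_not (s := coFootprint J) (fun p => α ≤ p.1 + p.2)]
  congr 2
  · exact filter_congr fun p _ => by omega
  · exact filter_congr fun p _ => by omega

lemma newtonBasis_mem_lowerPart (p : Fin (Fintype.card F) × Fin (Fintype.card F)) {n : ℕ}
    (h : gradedKey p < n) : newtonBasis F p ∈ lowerPart (newtonBasis F) gradedKey n := by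
  intro p' hp'
  rw [Module.Basis.repr_self, Finsupp.single_eq_of_ne]
  rintro rfl
  omega

/-- Multiplication by the first coordinate raises the graded key by exactly `q + 1`. At the edge of
the box the higher Newton word is zero on `F²`, so there the key does not rise at all. -/
lemma leadingIndices_succ_left {J : Finset (Fin 2 → F)}
    {p p' : Fin (Fintype.card F) × Fin (Fintype.card F)} (h1 : (p'.1 : ℕ) = p.1 + 1)
    (h2 : p'.2 = p.2) (hp : p ∈ leadingIndices (newtonBasis F) gradedKey (subcodeOn ⊤ J)) :
    p' ∈ leadingIndices (newtonBasis F) gradedKey (subcodeOn ⊤ J) := by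
  have hmul : ∀ r r' : Fin (Fintype.card F) × Fin (Fintype.card F), (r'.1 : ℕ) = r.1 + 1 →
      r'.2 = r.2 → mulCoord F 0 (newtonBasis F r) =
        newtonBasis F r' + enumField F r.1 • newtonBasis F r := by
    intro r r' h h'
    rw [newtonBasis_apply, newtonBasis_apply, mulCoord_zero_newtonWord, h, h']
  have hk : ∀ r r' : Fin (Fintype.card F) × Fin (Fintype.card F), (r'.1 : ℕ) = r.1 + 1 →
      r'.2 = r.2 → gradedKey r' = gradedKey r + (Fintype.card F + 1) := by
    intro r r' h h'
    simp only [gradedKey, h, h']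
    ring
  refine mem_leadingIndices_of_map (M := mulCoord F 0) (p := p) (d := Fintype.card F + 1)
    gradedKey_injective (mulCoord_mem_subcodeOn 0) (fun r => ?_) (hk p p' h1 h2) ?_ hp
  · by_cases hr : (r.1 : ℕ) + 1 < Fintype.card F
    · rw [hmul r (⟨r.1 + 1, hr⟩, r.2) rfl rfl]
      refine Submodule.add_mem _ (newtonBasis_mem_lowerPart _ ?_)
        (Submodule.smul_mem _ _ (newtonBasis_mem_lowerPart _ (by omega)))
      rw [hk r (⟨r.1 + 1, hr⟩, r.2) rfl rfl]
      omega
    · have : (r.1 : ℕ) + 1 = Fintype.card F := by have := r.1.2; omega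
      rw [newtonBasis_apply, mulCoord_zero_newtonWord, this, newtonWord_card_left, zero_add,
        ← newtonBasis_apply]
      exact Submodule.smul_mem _ _ (newtonBasis_mem_lowerPart _ (by omega))
  · have hne : p ≠ p' := by
      rintro rfl
      omega
    simp [hmul p p' h1 h2, hne]

lemma leadingIndices_succ_right {J : Finset (Fin 2 → F)}
    {p p' : Fin (Fintype.card F) × Fin (Fintype.card F)} (h1 : p'.1 = p.1)
    (h2 : (p'.2 : ℕ) = p.2 + 1)
    (hp : p ∈ leadingIndices (newtonBasis F) gradedKey (subcodeOn ⊤ J)) :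
    p' ∈ leadingIndices (newtonBasis F) gradedKey (subcodeOn ⊤ J) := by
  have hmul : ∀ r r' : Fin (Fintype.card F) × Fin (Fintype.card F), r'.1 = r.1 →
      (r'.2 : ℕ) = r.2 + 1 → mulCoord F 1 (newtonBasis F r) =
        newtonBasis F r' + enumField F r.2 • newtonBasis F r := by
    intro r r' h h'
    rw [newtonBasis_apply, newtonBasis_apply, mulCoord_one_newtonWord, h, h']
  have hk : ∀ r r' : Fin (Fintype.card F) × Fin (Fintype.card F), r'.1 = r.1 →
      (r'.2 : ℕ) = r.2 + 1 → gradedKey r' = gradedKey r + Fintype.card F := by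
    intro r r' h h'
    simp only [gradedKey, h, h']
    ring
  refine mem_leadingIndices_of_map (M := mulCoord F 1) (p := p) (d := Fintype.card F)
    gradedKey_injective (mulCoord_mem_subcodeOn 1) (fun r => ?_) (hk p p' h1 h2) ?_ hp
  · by_cases hr : (r.2 : ℕ) + 1 < Fintype.card F
    · rw [hmul r (r.1, ⟨r.2 + 1, hr⟩) rfl rfl]
      refine Submodule.add_mem _ (newtonBasis_mem_lowerPart _ ?_)
        (Submodule.smul_mem _ _ (newtonBasis_mem_lowerPart _ (by omega)))
      rw [hk r (r.1, ⟨r.2 + 1, hr⟩) rfl rfl]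
      omega
    · have : (r.2 : ℕ) + 1 = Fintype.card F := by have := r.2.2; omega
      rw [newtonBasis_apply, mulCoord_one_newtonWord, this, newtonWord_card_right, zero_add,
        ← newtonBasis_apply]
      exact Submodule.smul_mem _ _ (newtonBasis_mem_lowerPart _ (by omega))
  · have hne : p ≠ p' := by
      rintro rfl
      omega
    simp [hmul p p' h1 h2, hne]

lemma isLowerSet_coFootprint (J : Finset (Fin 2 → F)) :
    IsLowerSet (coFootprint J : Set (ℕ × ℕ)) := by
  have flip : ∀ i j : ℕ, (hi : i < Fintype.card F) → (hj : j < Fintype.card F) →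
      ((i, j) ∈ coFootprint J ↔ ((Fin.rev ⟨i, hi⟩, Fin.rev ⟨j, hj⟩) :
        Fin (Fintype.card F) × Fin (Fintype.card F)) ∈
          leadingIndices (newtonBasis F) gradedKey (subcodeOn ⊤ J)) := by
    intro i j hi hj
    rw [← mem_coFootprint]
    simp
  have box : ∀ i j : ℕ, (i, j) ∈ coFootprint J → i < Fintype.card F ∧ j < Fintype.card F := by
    intro i j h
    simpa using coFootprint_subset J h
  have left : ∀ i j : ℕ, (i + 1, j) ∈ coFootprint J → (i, j) ∈ coFootprint J := by
    intro i j h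
    have hb := box _ _ h
    rw [flip _ _ hb.1 hb.2] at h
    rw [flip _ _ (Nat.lt_of_succ_lt hb.1) hb.2]
    refine leadingIndices_succ_left ?_ ?_ h <;> simp only [Fin.val_rev]
    omega
  have right : ∀ i j : ℕ, (i, j + 1) ∈ coFootprint J → (i, j) ∈ coFootprint J := by
    intro i j h
    have hb := box _ _ h
    rw [flip _ _ hb.1 hb.2] at h
    rw [flip _ _ hb.1 (Nat.lt_of_succ_lt hb.2)]
    refine leadingIndices_succ_right ?_ ?_ h <;> simp only [Fin.val_rev]
    omega
  rintro ⟨i, j⟩ ⟨i', j'⟩ ⟨hi, hj⟩ h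
  simp only [mem_coe] at hi hj h ⊢
  obtain ⟨d, rfl⟩ := Nat.exists_eq_add_of_le hi
  obtain ⟨e, rfl⟩ := Nat.exists_eq_add_of_le hj
  have h1 : (i', j' + e) ∈ coFootprint J := by
    clear hi
    induction d with
    | zero => exact h
    | succ d ih => exact ih (left _ _ h)
  clear h hj hi
  induction e with
  | zero => exact h1
  | succ e ih => exact ih (right _ _ h1)

/-- Take for `J` the grid points indexed by the reversal of `X`. A Newton word vanishes at every
grid point whose index does not dominate its own, so the Newton words with reversed index in `X` are
supported on `J`. This gives one inclusion, and equal cardinalities give the other. -/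
theorem exists_coFootprint_eq {X : Finset (ℕ × ℕ)} (hX : IsLowerSet (X : Set (ℕ × ℕ)))
    (hq : X ⊆ range (Fintype.card F) ×ˢ range (Fintype.card F)) :
    ∃ J : Finset (Fin 2 → F), coFootprint J = X := by
  classical
  have box : ∀ i j : ℕ, (i, j) ∈ X → i < Fintype.card F ∧ j < Fintype.card F := by
    intro i j h
    simpa using hq h
  set g : ℕ × ℕ → (Fin 2 → F) := fun p =>
    ![enumField F (Fintype.card F - 1 - p.1), enumField F (Fintype.card F - 1 - p.2)] with hg
  refine ⟨X.image g, ?_⟩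
  have hcard : #(X.image g) = #X := by
    refine card_image_of_injOn ?_
    rintro ⟨i, j⟩ h ⟨i', j'⟩ h' e
    have hb := box _ _ h
    have hb' := box _ _ h'
    have e0 := congrFun e 0
    have e1 := congrFun e 1
    simp only [hg, Matrix.cons_val_zero, Matrix.cons_val_one] at e0 e1
    have := enumField_injOn (by omega) (by omega) e0
    have := enumField_injOn (by omega) (by omega) e1
    ext <;> simp only <;> omega
  refine (eq_of_subset_of_card_le ?_ ?_).symm
  · rintro ⟨i, j⟩ h
    have hb := box _ _ h
    have e : (i, j) = (((Fin.rev (⟨i, hb.1⟩ : Fin (Fintype.card F))).rev : ℕ),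
        ((Fin.rev (⟨j, hb.2⟩ : Fin (Fintype.card F))).rev : ℕ)) := by simp
    rw [e]
    refine (mem_coFootprint (Fin.rev ⟨i, hb.1⟩, Fin.rev ⟨j, hb.2⟩)).2 ⟨newtonBasis F
      (Fin.rev ⟨i, hb.1⟩, Fin.rev ⟨j, hb.2⟩), ⟨trivial, fun P hP => ?_⟩,
      newtonBasis_mem_lowerPart _ (Nat.lt_succ_self _), by simp⟩
    obtain ⟨k, hk, hk'⟩ := exists_enumField (P 0)
    obtain ⟨l, hl, hl'⟩ := exists_enumField (P 1)
    rw [newtonBasis_apply, newtonWord, ← hk', ← hl']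
    simp only [Fin.val_rev]
    by_contra h0
    have h1 := left_ne_zero_of_mul h0
    have h2 := right_ne_zero_of_mul h0
    rw [prod_ne_zero_iff] at h1 h2
    have hk2 : Fintype.card F - (i + 1) ≤ k := by
      by_contra! hc
      exact h1 k (mem_range.2 hc) (sub_self _)
    have hl2 : Fintype.card F - (j + 1) ≤ l := by
      by_contra! hc
      exact h2 l (mem_range.2 hc) (sub_self _)
    refine hP (mem_image.2 ⟨(Fintype.card F - 1 - k, Fintype.card F - 1 - l),
      hX (a := (i, j)) ⟨?_, ?_⟩ h, ?_⟩)
    · simp only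
      omega
    · simp only
      omega
    · funext x
      fin_cases x
      · change enumField F (Fintype.card F - 1 - (Fintype.card F - 1 - k)) = P 0
        rw [← hk']
        congr 1
        omega
      · change enumField F (Fintype.card F - 1 - (Fintype.card F - 1 - l)) = P 1
        rw [← hl']
        congr 1
        omega
  · rw [card_coFootprint, hcard]

end Footprint

/-! ### Weights and dimensions through column sums. -/

section Weights

variable {F : Type*} [Field F] [Fintype F]

lemma coFootprint_univ [DecidableEq F] : coFootprint (univ : Finset (Fin 2 → F)) =
    range (Fintype.card F) ×ˢ range (Fintype.card F) :=
  eq_of_subset_of_card_le (coFootprint_subset _) (by rw [card_coFootprint]; simp [sq])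

lemma finrank_reedMuller_add {u : ℤ} {α : ℕ} (h : u = 2 * ((Fintype.card F : ℤ) - 1) - α) :
    Module.finrank F (reedMuller F u 2) + columnSum (Fintype.card F) α (Fintype.card F) =
      Fintype.card F ^ 2 := by
  classical
  have h1 := finrank_subcodeOn_add_belowCount (F := F) univ h
  have h2 : subcodeOn (reedMuller F u 2) univ = reedMuller F u 2 := by
    ext c
    simp [subcodeOn]
  rw [h2, coFootprint_univ, belowCount_columns] at h1
  rw [h1]
  simp

theorem rghw_reedMuller_eq {u₁ u₂ : ℤ} {α β A m : ℕ} (hαβ : α ≤ β)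
    (hu₁ : u₁ = 2 * ((Fintype.card F : ℤ) - 1) - α)
    (hu₂ : u₂ = 2 * ((Fintype.card F : ℤ) - 1) - β) (hA : A < Fintype.card F)
    (h1 : columnSum (Fintype.card F) β A < m + columnSum (Fintype.card F) α A)
    (h2 : m + columnSum (Fintype.card F) α (A + 1) ≤ columnSum (Fintype.card F) β (A + 1)) :
    rghw (reedMuller F u₁ 2) (reedMuller F u₂ 2) m =
      m + columnSum (Fintype.card F) α (A + 1) := by
  refine IsLeast.csInf_eq ⟨?_, ?_⟩
  · obtain ⟨X, hX, hXq, hcard, hband⟩ := exists_band_eq hαβ hA h1 h2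
    obtain ⟨J, rfl⟩ := exists_coFootprint_eq hX hXq
    refine ⟨J, by rw [← hcard, card_coFootprint], ?_⟩
    have e1 := finrank_subcodeOn_add_belowCount J hu₁
    have e2 := finrank_subcodeOn_add_belowCount J hu₂
    omega
  · rintro _ ⟨J, rfl, hJ⟩
    have e1 := finrank_subcodeOn_add_belowCount J hu₁
    have e2 := finrank_subcodeOn_add_belowCount J hu₂
    rw [← card_coFootprint]
    exact le_card_of_le_band (isLowerSet_coFootprint J) (coFootprint_subset J) hαβ hA h1 (by omega)

/-- The box lies below the diagonal `2q - 1`, so with this upper boundary the band count is the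
dimension of the subcode on `J` itself. -/
theorem ghw_reedMuller_eq {u : ℤ} {α A r : ℕ} (hα : α ≤ 2 * Fintype.card F - 1)
    (hu : u = 2 * ((Fintype.card F : ℤ) - 1) - α) (hA : A < Fintype.card F)
    (h1 : columnSum (Fintype.card F) (2 * Fintype.card F - 1) A <
      r + columnSum (Fintype.card F) α A)
    (h2 : r + columnSum (Fintype.card F) α (A + 1) ≤
      columnSum (Fintype.card F) (2 * Fintype.card F - 1) (A + 1)) :
    ghw (reedMuller F u 2) r = r + columnSum (Fintype.card F) α (A + 1) := by
  classical
  have hall : ∀ J : Finset (Fin 2 → F),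
      belowCount (coFootprint J) (2 * Fintype.card F - 1) = #J := by
    intro J
    rw [belowCount, filter_true_of_mem, card_coFootprint]
    intro p hp
    have := coFootprint_subset J hp
    simp only [mem_product, mem_range] at this
    omega
  have lower : ∀ J : Finset (Fin 2 → F),
      r ≤ Module.finrank F (subcodeOn (reedMuller F u 2) J) →
        r + columnSum (Fintype.card F) α (A + 1) ≤ #J := by
    intro J hJ
    have e1 := finrank_subcodeOn_add_belowCount J hu
    rw [← card_coFootprint]
    exact le_card_of_le_band (isLowerSet_coFootprint J) (coFootprint_subset J) hα hA h1
      (by rw [hall]; omega)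
  have lowerD : ∀ D : Submodule F ((Fin 2 → F) → F), D ≤ reedMuller F u 2 →
      Module.finrank F D = r →
        r + columnSum (Fintype.card F) α (A + 1) ≤ (codeSupp D).ncard := by
    intro D hD hr
    -- `D` is contained in the subcode on its own support. That subcode may be larger than `D`,
    -- which is why `lower` assumes only an inequality.
    rw [Set.ncard_eq_toFinset_card']
    refine lower _ (hr ▸ Submodule.finrank_mono fun c hc => ⟨hD hc, fun P hP => ?_⟩)
    by_contra h0
    exact hP (Set.mem_toFinset.2 ⟨c, hc, h0⟩)
  refine IsLeast.csInf_eq ⟨?_, ?_⟩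
  · obtain ⟨X, hX, hXq, hcard, hband⟩ := exists_band_eq hα hA h1 h2
    obtain ⟨J, rfl⟩ := exists_coFootprint_eq hX hXq
    have e1 := finrank_subcodeOn_add_belowCount J hu
    rw [hall] at hband
    have hr : Module.finrank F (subcodeOn (reedMuller F u 2) J) = r := by omega
    have hle : subcodeOn (reedMuller F u 2) J ≤ reedMuller F u 2 := fun c hc => hc.1
    refine ⟨subcodeOn (reedMuller F u 2) J, hle, hr, le_antisymm ?_ (lowerD _ hle hr)⟩
    rw [← hcard, card_coFootprint, ← Set.ncard_coe_finset]
    refine Set.ncard_le_ncard ?_ (Set.toFinite _)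
    rintro P ⟨c, hc, hcP⟩
    by_contra hP
    exact hcP (hc.2 P hP)
  · rintro _ ⟨D, hD, hr, rfl⟩
    exact lowerD D hD hr

end Weights

/-! ### Closed forms of column sums, and locating the last column. -/

section ColumnSums

lemma columnSum_succ (q s a : ℕ) : columnSum q s (a + 1) = columnSum q s a + min q (s - a) :=
  sum_range_succ _ _

lemma columnSum_of_le {q s a : ℕ} (hs : s ≤ q) (ha : a ≤ s + 1) :
    (columnSum q s a : ℚ) = a * s - a * (a - 1) / 2 := by
  induction a with
  | zero => simp [columnSum]
  | succ a ih =>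
    rw [columnSum_succ, min_eq_right (by omega), Nat.cast_add, ih (by omega),
      Nat.cast_sub (by omega)]
    push_cast
    ring

lemma columnSum_of_ge {q s a : ℕ} (hs : s ≤ q) (ha : s ≤ a) :
    (columnSum q s a : ℚ) = s * (s + 1) / 2 := by
  induction a, ha using Nat.le_induction with
  | base =>
    rw [columnSum_of_le hs (Nat.le_succ s)]
    ring
  | succ a h ih => rw [columnSum_succ, Nat.sub_eq_zero_of_le h, min_eq_right (Nat.zero_le _),
      add_zero, ih]

lemma columnSum_of_add_le {q s a : ℕ} (ha : q + a ≤ s + 1) : (columnSum q s a : ℚ) = a * q := by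
  induction a with
  | zero => simp [columnSum]
  | succ a ih =>
    rw [columnSum_succ, min_eq_left (by omega), Nat.cast_add, ih (by omega)]
    push_cast
    ring

/-- The last term is the triangle that the ceiling `q` cuts off from the first `s - q` columns. It
also vanishes when `s = q - 1`. -/
lemma columnSum_of_le_add {q s a : ℕ} (hs : q ≤ s + 1) (hsa : s ≤ a + q) (ha : a ≤ s + 1) :
    (columnSum q s a : ℚ) = a * s - a * (a - 1) / 2 - (s - q) * (s - q + 1) / 2 := by
  rcases eq_or_lt_of_le hs with rfl | hs
  · rw [columnSum_of_le (Nat.le_succ s) ha]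
    push_cast
    ring
  obtain ⟨d, rfl⟩ := Nat.exists_eq_add_of_le (Nat.le_of_lt_succ hs)
  have hd : d ≤ a := by omega
  induction a, hd using Nat.le_induction with
  | base =>
    rw [columnSum_of_add_le (by omega)]
    push_cast
    ring
  | succ a h ih =>
    rw [columnSum_succ, min_eq_right (by omega), Nat.cast_add, ih (by omega) (by omega),
      Nat.cast_sub (by omega)]
    push_cast
    ring

lemma exists_column {q α β lo hi m : ℕ} (h : lo ≤ hi)
    (h1 : columnSum q β lo < m + columnSum q α lo)
    (h2 : m + columnSum q α hi ≤ columnSum q β hi) :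
    ∃ A, lo ≤ A ∧ A < hi ∧ columnSum q β A < m + columnSum q α A ∧
      m + columnSum q α (A + 1) ≤ columnSum q β (A + 1) := by
  induction hi, h using Nat.le_induction with
  | base => omega
  | succ hi h ih =>
    rcases lt_or_ge (columnSum q β hi) (m + columnSum q α hi) with h3 | h3
    · exact ⟨hi, h, Nat.lt_succ_self hi, h3, h2⟩
    · obtain ⟨A, hA⟩ := ih h3
      exact ⟨A, hA.1, by omega, hA.2.2⟩

/-- `M m` is the minimal size of a lower set of the `q × q` box with `m` points in the band
`α ≤ i + j < β`, as obtained by filling up whole columns. -/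
def IsColumnWeight (q α β : ℕ) (M : ℕ → ℕ) : Prop :=
  ∀ A m, A < q → columnSum q β A < m + columnSum q α A →
    m + columnSum q α (A + 1) ≤ columnSum q β (A + 1) → M m = m + columnSum q α (A + 1)

variable {q α β lo hi m : ℕ} {M : ℕ → ℕ} {N T : ℕ → ℚ}

/-- Here `N A` counts the band points in the first `A` columns, and `b` is the number of band points
needed from column `A`. -/
lemma exists_column_offset (h : lo ≤ hi)
    (hN : ∀ A, lo ≤ A → A ≤ hi → (columnSum q β A : ℚ) - columnSum q α A = N A)
    (h1 : N lo < m) (h2 : (m : ℚ) ≤ N hi) :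
    ∃ A b : ℕ, lo ≤ A ∧ A < hi ∧ 1 ≤ b ∧ (b : ℚ) ≤ N (A + 1) - N A ∧ (m : ℚ) = N A + b := by
  obtain ⟨A, hlo, hhi, h3, h4⟩ := exists_column (q := q) (α := α) (β := β) (m := m) h
    (by
      rw [← hN lo le_rfl h] at h1
      have : (columnSum q β lo : ℚ) < m + columnSum q α lo := by linarith
      exact_mod_cast this)
    (by
      rw [← hN hi h le_rfl] at h2
      have : (m : ℚ) + columnSum q α hi ≤ columnSum q β hi := by linarith
      exact_mod_cast this)
  obtain ⟨b, hb⟩ := Nat.exists_eq_add_of_lt h3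
  have hb' : (m : ℚ) + columnSum q α A = columnSum q β A + b + 1 := by exact_mod_cast hb
  have h4' : (m : ℚ) + columnSum q α (A + 1) ≤ columnSum q β (A + 1) := by exact_mod_cast h4
  have e1 := hN A hlo hhi.le
  have e2 := hN (A + 1) (by omega) hhi
  refine ⟨A, b + 1, hlo, hhi, by omega, ?_, ?_⟩
  · push_cast
    linarith
  · push_cast
    linarith

lemma IsColumnWeight.eq_of_offset (hM : IsColumnWeight q α β M) (hq : hi ≤ q)
    (hN : ∀ A, lo ≤ A → A ≤ hi → (columnSum q β A : ℚ) - columnSum q α A = N A)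
    (hT : ∀ A, lo ≤ A → A < hi → (columnSum q α (A + 1) : ℚ) = T A)
    {A b : ℕ} (hlo : lo ≤ A) (hhi : A < hi) (hb : 1 ≤ b) (hb' : (b : ℚ) ≤ N (A + 1) - N A)
    (hm : (m : ℚ) = N A + b) : (M m : ℚ) = m + T A := by
  have e1 := hN A hlo hhi.le
  have e2 := hN (A + 1) (by omega) hhi
  have hb1 : (1 : ℚ) ≤ b := by exact_mod_cast hb
  have h1 : (columnSum q β A : ℚ) < m + columnSum q α A := by linarith
  have h2 : (m : ℚ) + columnSum q α (A + 1) ≤ columnSum q β (A + 1) := by linarith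
  rw [hM A m (by omega) (by exact_mod_cast h1) (by exact_mod_cast h2), ← hT A hlo hhi]
  push_cast
  rfl

/-- Once `A + 1 ≥ α`, the whole triangle below the band is included, so each further band point
costs exactly one and the column need not be known. -/
lemma IsColumnWeight.eq_of_ge (hM : IsColumnWeight q α β M) (hα : α ≤ q) (hlo : α ≤ lo + 1)
    (hq : lo ≤ q) (h1 : (columnSum q β lo : ℚ) - columnSum q α lo < m)
    (h2 : (m : ℚ) ≤ columnSum q β q - columnSum q α q) : (M m : ℚ) = m + α * (α + 1) / 2 := by
  have h1' : (columnSum q β lo : ℚ) < m + columnSum q α lo := by linarith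
  have h2' : (m : ℚ) + columnSum q α q ≤ columnSum q β q := by linarith
  obtain ⟨A, hA, hAq, h3, h4⟩ := exists_column (q := q) (α := α) (β := β) (m := m) hq
    (by exact_mod_cast h1') (by exact_mod_cast h2')
  rw [hM A m hAq h3 h4, Nat.cast_add, columnSum_of_ge hα (by omega)]

end ColumnSums

/-! ### Explicit weights by the position of the band. -/

section Cases

variable {q α t : ℕ} {M : ℕ → ℕ} {u₂ : ℤ}

/-- The weights when the band starts and ends in the lower half of the box. -/
theorem IsColumnWeight.band_low (hM : IsColumnWeight q α (α + t) M)
    (hu : u₂ = 2 * ((q : ℤ) - 1) - α - t) (hq : α + t ≤ q) :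
    (∀ m : ℕ, 1 ≤ m → (m : ℚ) ≤ t * (2 * q - u₂ - t - 2) →
      (∃ a b : ℕ, (a : ℤ) ≤ 2 * (q - 1) - u₂ - t - 1 ∧ 1 ≤ b ∧ b ≤ t ∧ m = a * t + b) ∧
      (∀ a b : ℕ, (a : ℤ) ≤ 2 * (q - 1) - u₂ - t - 1 → 1 ≤ b → b ≤ t → m = a * t + b →
        (M m : ℚ) = (2 * q - 2 - u₂ - a / 2) * (a + 1) + b - t)) ∧
    (∀ m : ℕ, t * (2 * q - u₂ - t - 2) + 1 ≤ (m : ℚ) →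
      (m : ℚ) ≤ t * (2 * q - u₂ - t - 2) + t * (t + 1) / 2 →
      (∃ c : ℕ, 1 ≤ c ∧ (c : ℚ) ≤ t * (t + 1) / 2 ∧
        (m : ℚ) = t * (2 * q - u₂ - t - 2) + c) ∧
      (∀ c : ℕ, 1 ≤ c → (c : ℚ) ≤ t * (t + 1) / 2 →
        (m : ℚ) = t * (2 * q - u₂ - t - 2) + c →
        (M m : ℚ) = 1 / 2 * (2 * q - u₂ - t - 2) * (2 * q - u₂ + t - 1) + c)) := by
  have hu' : (u₂ : ℚ) = 2 * ((q : ℚ) - 1) - α - t := by rw [hu]; push_cast; ring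
  have hX : (t : ℚ) * (2 * q - u₂ - t - 2) = t * α := by rw [hu']; ring
  rw [hX]
  -- Each of the first `α` columns crosses the full width `t` of the band. The `t(t+1)/2` band
  -- points beyond them fall under `eq_of_ge`.
  have hN : ∀ A, 0 ≤ A → A ≤ α →
      (columnSum q (α + t) A : ℚ) - columnSum q α A = (fun A : ℕ => (t : ℚ) * A) A := by
    intro A _ hA
    rw [columnSum_of_le hq (by omega), columnSum_of_le (by omega) (by omega)]
    push_cast
    ring
  have hT : ∀ A, 0 ≤ A → A < α → (columnSum q α (A + 1) : ℚ) =
      (fun A : ℕ => ((A : ℚ) + 1) * α - (A + 1) * A / 2) A := by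
    intro A _ hA
    rw [columnSum_of_le (by omega) (by omega)]
    push_cast
    ring
  refine ⟨fun m hm hm' => ⟨?_, ?_⟩, fun m hm hm' => ⟨?_, ?_⟩⟩
  · obtain ⟨A, b, -, hA, hb, hbt, e⟩ := exists_column_offset (Nat.zero_le α) hN
      (by simpa using Nat.lt_of_succ_le hm) hm'
    refine ⟨A, b, by omega, hb, ?_, ?_⟩
    · push_cast at hbt
      have : (b : ℚ) ≤ t := by linarith
      exact_mod_cast this
    · have : (m : ℚ) = A * t + b := by rw [e]; ring
      exact_mod_cast this
  · intro a b ha hb hbt e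
    have hbt' : (b : ℚ) ≤ t := by exact_mod_cast hbt
    have e' : (m : ℚ) = a * t + b := by exact_mod_cast e
    rw [hM.eq_of_offset (A := a) (b := b) (by omega) hN hT (Nat.zero_le a) (by omega) hb
      (by push_cast; linarith) (by linarith), e', hu']
    ring
  · obtain ⟨c, rfl⟩ : ∃ c, m = t * α + c := by
      apply Nat.exists_eq_add_of_le
      have : ((t : ℚ) * α) ≤ m := by linarith
      exact_mod_cast this
    push_cast at hm hm' ⊢
    refine ⟨c, ?_, by linarith, rfl⟩
    have : (1 : ℚ) ≤ c := by linarith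
    exact_mod_cast this
  · intro c hc hc' e
    have hc1 : (1 : ℚ) ≤ c := by exact_mod_cast hc
    rw [hM.eq_of_ge (lo := α) (by omega) (by omega) (by omega)
      (by rw [hN α (Nat.zero_le α) le_rfl]; linarith)
      (by
        rw [columnSum_of_ge hq hq, columnSum_of_ge (by omega) (by omega), e]
        push_cast
        linarith), e, hu']
    ring

/-- The weights when the band starts and ends in the upper half of the box. -/
theorem IsColumnWeight.band_high (hM : IsColumnWeight q α (α + t) M)
    (hu : u₂ = 2 * ((q : ℤ) - 1) - α - t) (hu₂ : -1 ≤ u₂) (hq : q ≤ α + 1) :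
    (∀ m : ℕ, 1 ≤ m → (m : ℚ) ≤ t * (t + 1) / 2 →
      (∃ a b : ℕ, a + 1 ≤ t ∧ 1 ≤ b ∧ b ≤ a + 1 ∧ (m : ℚ) = a * (a + 1) / 2 + b) ∧
      (∀ a b : ℕ, a + 1 ≤ t → 1 ≤ b → b ≤ a + 1 → (m : ℚ) = a * (a + 1) / 2 + b →
        (M m : ℚ) = q * (q - u₂ - t + a) + b - a - 1)) ∧
    (∀ m : ℕ, t * (t + 1) / 2 + 1 ≤ (m : ℚ) →
      (m : ℚ) ≤ t * (t + 1) / 2 + t * (u₂ + 1) →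
      (∃ a b : ℕ, (a : ℤ) ≤ u₂ ∧ 1 ≤ b ∧ b ≤ t ∧ (m : ℚ) = t * (t + 1) / 2 + a * t + b) ∧
      (∀ a b : ℕ, (a : ℤ) ≤ u₂ → 1 ≤ b → b ≤ t → (m : ℚ) = t * (t + 1) / 2 + a * t + b →
        (M m : ℚ) = q * (q + a - u₂) + b - t - 1 - a * (a + 3) / 2)) := by
  -- The first `δ = α + 1 - q` columns lie entirely below the band. The next `t` columns contribute
  -- `1, 2, …, t` points, and every later one contributes `t`.
  obtain ⟨δ, hδ⟩ := Nat.exists_eq_add_of_le hq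
  have hαδ : (α : ℚ) = q + δ - 1 := by
    have : (α : ℚ) + 1 = q + δ := by exact_mod_cast hδ
    linarith
  have hu' : (u₂ : ℚ) = q - 1 - δ - t := by
    rw [hu]
    push_cast
    rw [hαδ]
    ring
  have hN : ∀ A, δ ≤ A → A ≤ δ + t → (columnSum q (α + t) A : ℚ) - columnSum q α A =
      (fun A : ℕ => ((A : ℚ) - δ) * (A - δ + 1) / 2) A := by
    intro A h1 h2
    rw [columnSum_of_add_le (by omega), columnSum_of_le_add hq (by omega) (by omega), hαδ]
    ring
  have hN' : ∀ A, δ + t ≤ A → A ≤ q → (columnSum q (α + t) A : ℚ) - columnSum q α A =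
      (fun A : ℕ => (t : ℚ) * (t + 1) / 2 + (A - δ - t) * t) A := by
    intro A h1 h2
    rw [columnSum_of_le_add (by omega) (by omega) (by omega),
      columnSum_of_le_add hq (by omega) (by omega)]
    push_cast
    rw [hαδ]
    ring
  have hT : ∀ A, δ ≤ A → A < q → (columnSum q α (A + 1) : ℚ) = (fun A : ℕ => ((A : ℚ) + 1) *
      (q + δ - 1) - (A + 1) * A / 2 - (δ - 1) * δ / 2) A := by
    intro A h1 h2
    rw [columnSum_of_le_add hq (by omega) (by omega)]
    push_cast
    rw [hαδ]
    ring
  refine ⟨fun m hm hm' => ⟨?_, ?_⟩, fun m hm hm' => ⟨?_, ?_⟩⟩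
  · obtain ⟨A, b, h1, h2, hb, hb', e⟩ := exists_column_offset (Nat.le_add_right δ t) hN
      (by simpa using Nat.lt_of_succ_le hm) (by push_cast; linarith)
    obtain ⟨a, rfl⟩ := Nat.exists_eq_add_of_le h1
    push_cast at hb' e
    refine ⟨a, b, by omega, hb, ?_, by rw [e]; ring⟩
    have : (b : ℚ) ≤ a + 1 := by linarith
    exact_mod_cast this
  · intro a b ha hb hb' e
    have hb'' : (b : ℚ) ≤ a + 1 := by exact_mod_cast hb'
    rw [hM.eq_of_offset (A := δ + a) (b := b) (by omega) hN
      (fun A h1 h2 => hT A h1 (by omega)) (Nat.le_add_right δ a) (by omega) hb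
      (by push_cast; linarith) (by push_cast; linarith), e, hu']
    push_cast
    ring
  · obtain ⟨A, b, h1, h2, hb, hb', e⟩ := exists_column_offset (m := m)
      (show δ + t ≤ q by omega) hN' (by push_cast; linarith)
      (by rw [hu'] at hm'; linarith)
    obtain ⟨a, rfl⟩ := Nat.exists_eq_add_of_le h1
    push_cast at hb' e
    refine ⟨a, b, by omega, hb, ?_, by rw [e]; ring⟩
    have : (b : ℚ) ≤ t := by linarith
    exact_mod_cast this
  · intro a b ha hb hb' e
    have hb'' : (b : ℚ) ≤ t := by exact_mod_cast hb'
    rw [hM.eq_of_offset (A := δ + t + a) (b := b) le_rfl hN'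
      (fun A h1 h2 => hT A (by omega) h2) (Nat.le_add_right _ a) (by omega) hb
      (by push_cast; linarith) (by push_cast; linarith), e, hu']
    push_cast
    ring

/-- The weights when the band starts in the lower half and ends in the upper half of the box, and
has width at most `q`. -/
theorem IsColumnWeight.band_middle (hM : IsColumnWeight q α (α + t) M)
    (hu : u₂ = 2 * ((q : ℤ) - 1) - α - t) (ht : 1 ≤ t) (hα : α + 2 ≤ q) (hk : q < α + t)
    (htq : t ≤ q) :
    (∀ m : ℕ, 1 ≤ m → (m : ℚ) ≤ 1 / 2 * (q - u₂ - 2) * (2 * t - q + u₂ + 1) + t →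
      (∃ a b : ℕ, (a : ℤ) ≤ q - u₂ - 2 ∧ 1 ≤ b ∧ (b : ℤ) ≤ u₂ + t - q + a + 2 ∧
        (m : ℚ) = a * (u₂ + t - q + 1) + a * (a + 1) / 2 + b) ∧
      (∀ a b : ℕ, (a : ℤ) ≤ q - u₂ - 2 → 1 ≤ b → (b : ℤ) ≤ u₂ + t - q + a + 2 →
        (m : ℚ) = a * (u₂ + t - q + 1) + a * (a + 1) / 2 + b →
        (M m : ℚ) = (a + 2) * (q - 1) - u₂ - t + b)) ∧
    (∀ m : ℕ, 1 / 2 * (q - u₂ - 2) * (2 * t - q + u₂ + 1) + t + 1 ≤ (m : ℚ) →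
      (m : ℚ) ≤ 1 / 2 * (q - u₂ - 2) * (2 * t - q + u₂ + 1) + t * (q - t) →
      (∃ a b : ℕ, (a : ℤ) ≤ q - t - 2 ∧ 1 ≤ b ∧ b ≤ t ∧
        (m : ℚ) = 1 / 2 * (q - u₂ - 2) * (2 * t - q + u₂ + 1) + (a + 1) * t + b) ∧
      (∀ a b : ℕ, (a : ℤ) ≤ q - t - 2 → 1 ≤ b → b ≤ t →
        (m : ℚ) = 1 / 2 * (q - u₂ - 2) * (2 * t - q + u₂ + 1) + (a + 1) * t + b →
        (M m : ℚ) = q * (q - u₂ + a) - a * (a + 3) / 2 - t + b - 1)) ∧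
    (∀ m : ℕ, 1 ≤ m →
      1 / 2 * (q - u₂ - 2) * (2 * t - q + u₂ + 1) + t * (q - t) + 1 ≤ (m : ℚ) →
      (m : ℚ) ≤ (2 * q - u₂) * (u₂ + t) + 3 * (q - u₂) - q ^ 2 - 2 - t * (t + 3) / 2 →
      (∃ c : ℕ, 1 ≤ c ∧
        (c : ℚ) ≤ 1 / 2 * ((t + 1) ^ 2 - (q - u₂ - 1) ^ 2 + q - u₂ - t - 2) ∧
        (m : ℚ) = 1 / 2 * (q - u₂ - 2) * (2 * t - q + u₂ + 1) + t * (q - t) + c) ∧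
      (∀ c : ℕ, 1 ≤ c →
        (c : ℚ) ≤ 1 / 2 * ((t + 1) ^ 2 - (q - u₂ - 1) ^ 2 + q - u₂ - t - 2) →
        (m : ℚ) = 1 / 2 * (q - u₂ - 2) * (2 * t - q + u₂ + 1) + t * (q - t) + c →
        (M m : ℚ) =
          1 / 2 * (3 * q ^ 2 - 2 * u₂ * q - 3 * q - t ^ 2 - t) + c)) := by
  -- Here `k = q - 2 - u₂` is the excess of the upper boundary over `q`. In columns `0, …, k` the
  -- ceiling cuts the band, leaving `t - k, …, t` points. Columns `k + 1, …, α - 1` contribute `t`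
  -- each.
  obtain ⟨k, hk'⟩ := Nat.exists_eq_add_of_le hk.le
  have hαk : (α : ℚ) = q + k - t := by
    have : (α : ℚ) + t = q + k := by exact_mod_cast hk'
    linarith
  have hu' : (u₂ : ℚ) = q - 2 - k := by
    rw [hu]
    push_cast
    rw [hαk]
    ring
  have hN₁ : ∀ A, 0 ≤ A → A ≤ k + 1 → (columnSum q (α + t) A : ℚ) - columnSum q α A =
      (fun A : ℕ => (A : ℚ) * (t - k) + A * (A - 1) / 2) A := by
    intro A _ hA
    rw [columnSum_of_add_le (by omega), columnSum_of_le (by omega) (by omega), hαk]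
    ring
  have hN₂ : ∀ A, k + 1 ≤ A → A ≤ α → (columnSum q (α + t) A : ℚ) - columnSum q α A =
      (fun A : ℕ => (A : ℚ) * t - k * (k + 1) / 2) A := by
    intro A h1 h2
    rw [columnSum_of_le_add (by omega) (by omega) (by omega),
      columnSum_of_le (by omega) (by omega)]
    push_cast
    rw [hαk]
    ring
  -- This is not an instance of `hN₂`, whose range excludes `α = k`, the case `t = q`.
  have hNα : (columnSum q (α + t) α : ℚ) - columnSum q α α = α * t - k * (k + 1) / 2 := by
    rw [columnSum_of_le_add (by omega) (by omega) (by omega),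
      columnSum_of_le (by omega) (by omega)]
    push_cast
    rw [hαk]
    ring
  have hNq : (columnSum q (α + t) q : ℚ) - columnSum q α q =
      q * (q + k) - q * (q - 1) / 2 - k * (k + 1) / 2 - α * (α + 1) / 2 := by
    rw [columnSum_of_le_add (by omega) (by omega) (by omega),
      columnSum_of_ge (by omega) (by omega)]
    push_cast
    rw [hαk]
    ring
  have hT : ∀ A, A < α + 1 → (columnSum q α (A + 1) : ℚ) =
      (fun A : ℕ => ((A : ℚ) + 1) * (q + k - t) - (A + 1) * A / 2) A := by
    intro A hA
    rw [columnSum_of_le (by omega) (by omega)]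
    push_cast
    rw [hαk]
    ring
  refine ⟨fun m hm hm' => ⟨?_, ?_⟩, fun m hm hm' => ⟨?_, ?_⟩, fun m _ hm hm' => ⟨?_, ?_⟩⟩
  · obtain ⟨A, b, -, hA, hb, hb', e⟩ := exists_column_offset (Nat.zero_le (k + 1)) hN₁
      (by simpa using Nat.lt_of_succ_le hm) (by rw [hu'] at hm'; push_cast; linarith)
    push_cast at hb'
    refine ⟨A, b, by omega, hb, ?_, by rw [e, hu']; ring⟩
    have : (b : ℚ) ≤ u₂ + t - q + A + 2 := by rw [hu']; linarith
    exact_mod_cast this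
  · intro a b ha hb hb' e
    have hb'' : (b : ℚ) ≤ u₂ + t - q + a + 2 := by exact_mod_cast hb'
    rw [hu'] at hb'' e ⊢
    rw [hM.eq_of_offset (A := a) (b := b) (by omega) hN₁
      (fun A _ h2 => hT A (by omega)) (Nat.zero_le a) (by omega) hb
      (by push_cast; linarith) (by linarith), e]
    ring
  · rw [hu'] at hm hm' ⊢
    -- Since `α - k = q - t ≥ 0`, failure would force `t = q`, and then the range of `m` is empty.
    have hlo : k + 1 ≤ α := by
      by_contra! hc
      have : α = k := by omega
      have : (α : ℚ) = k := by exact_mod_cast this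
      have : (q : ℚ) = t := by linarith
      have : (1 : ℚ) ≤ t := by exact_mod_cast ht
      rw [‹(q : ℚ) = t›] at hm hm'
      linarith
    obtain ⟨A, b, h1, h2, hb, hb', e⟩ := exists_column_offset (m := m) hlo hN₂
      (by push_cast; linarith) (by rw [hαk]; linarith)
    obtain ⟨a, rfl⟩ := Nat.exists_eq_add_of_le h1
    push_cast at hb' e
    refine ⟨a, b, by omega, hb, ?_, by rw [e]; ring⟩
    have : (b : ℚ) ≤ t := by linarith
    exact_mod_cast this
  · intro a b ha hb hb' e
    have hb'' : (b : ℚ) ≤ t := by exact_mod_cast hb'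
    rw [hu'] at e ⊢
    rw [hM.eq_of_offset (A := k + 1 + a) (b := b) (by omega) hN₂
      (fun A _ h2 => hT A (by omega)) (Nat.le_add_right _ a) (by omega) hb
      (by push_cast; linarith) (by push_cast; linarith), e]
    push_cast
    ring
  · rw [hu'] at hm hm' ⊢
    -- The subtracted triangle is moved to the left to stay in `ℕ`. The division is exact because
    -- `k(k+1)` is even.
    obtain ⟨c, hc⟩ : ∃ c, m + k * (k + 1) / 2 = t * α + c := by
      apply Nat.exists_eq_add_of_le
      have : ((t : ℚ) * α) ≤ m + (k * (k + 1) / 2 : ℕ) := by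
        rw [Nat.cast_div (Nat.even_mul_succ_self k).two_dvd (by norm_num), hαk]
        push_cast
        linarith
      exact_mod_cast this
    have hc' : (m : ℚ) + k * (k + 1) / 2 = t * α + c := by
      have h := congrArg (Nat.cast (R := ℚ)) hc
      rw [Nat.cast_add, Nat.cast_div (Nat.even_mul_succ_self k).two_dvd (by norm_num)] at h
      push_cast at h
      exact h
    rw [hαk] at hc'
    refine ⟨c, ?_, by linarith, by linarith⟩
    have : (1 : ℚ) ≤ c := by linarith
    exact_mod_cast this
  · intro c hc hc' e
    have hc1 : (1 : ℚ) ≤ c := by exact_mod_cast hc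
    rw [hu'] at hc' e ⊢
    rw [hM.eq_of_ge (lo := α) (by omega) (by omega) (by omega)
      (by rw [hNα, hαk]; linarith) (by rw [hNq, hαk]; linarith), e, hαk]
    ring

/-- The weights when the band starts in the lower half and ends in the upper half of the box, and
has width more than `q`. -/
theorem IsColumnWeight.band_wide (hM : IsColumnWeight q α (α + t) M)
    (hu : u₂ = 2 * ((q : ℤ) - 1) - α - t) (hu₂ : -1 ≤ u₂) (hα : α + 2 ≤ q) (htq : q < t)
    {u : ℤ} (hut : u = u₂ + t) :
    (∀ m : ℕ, 1 ≤ m → (m : ℚ) ≤ q * (u + 2) - u * (u + 3) / 2 - 1 →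
      (∃ a b : ℕ, (a : ℤ) ≤ 2 * (q - 1) - u ∧ 1 ≤ b ∧ (b : ℤ) ≤ u - q + 2 + a ∧
        (m : ℚ) = a * (u - q + 1) + a * (a + 1) / 2 + b) ∧
      (∀ a b : ℕ, (a : ℤ) ≤ 2 * (q - 1) - u → 1 ≤ b → (b : ℤ) ≤ u - q + 2 + a →
        (m : ℚ) = a * (u - q + 1) + a * (a + 1) / 2 + b →
        (M m : ℚ) = (a + 2) * (q - 1) - u + b)) ∧
    (∀ m : ℕ, q * (u + 2) - u * (u + 3) / 2 ≤ (m : ℚ) →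
      (m : ℚ) ≤ (2 * q - u₂) * (u₂ + t) + 3 * (q - u₂) - q ^ 2 - 2 - t * (t + 3) / 2 →
      (∃ c : ℕ, 1 ≤ c ∧ (m : ℚ) = q * (u + 2) - u * (u + 3) / 2 - 1 + c) ∧
      (∀ c : ℕ, 1 ≤ c → (m : ℚ) = q * (u + 2) - u * (u + 3) / 2 - 1 + c →
        (M m : ℚ) = q * (2 * q - u - 1) + c)) := by
  have hu' : (u : ℚ) = 2 * (q - 1) - α := by
    rw [hut, hu]
    push_cast
    ring
  have hu₂' : (u₂ : ℚ) = 2 * (q - 1) - α - t := by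
    rw [hu]
    push_cast
    ring
  -- Because `t > q`, the first `α + 1` columns all reach the ceiling inside the band. They already
  -- contain the triangle below it, so no intermediate range with `t` points per column occurs.
  have hN : ∀ A, 0 ≤ A → A ≤ α + 1 → (columnSum q (α + t) A : ℚ) - columnSum q α A =
      (fun A : ℕ => (A : ℚ) * (q - α) + A * (A - 1) / 2) A := by
    intro A _ hA
    rw [columnSum_of_add_le (by omega), columnSum_of_le (by omega) (by omega)]
    ring
  have hNq : (columnSum q (α + t) q : ℚ) - columnSum q α q = q * (α + t) - q * (q - 1) / 2 -
      (α + t - q) * (α + t - q + 1) / 2 - α * (α + 1) / 2 := by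
    rw [columnSum_of_le_add (by omega) (by omega) (by omega),
      columnSum_of_ge (by omega) (by omega)]
    push_cast
    ring
  have hT : ∀ A, 0 ≤ A → A < α + 1 → (columnSum q α (A + 1) : ℚ) =
      (fun A : ℕ => ((A : ℚ) + 1) * α - (A + 1) * A / 2) A := by
    intro A _ hA
    rw [columnSum_of_le (by omega) (by omega)]
    push_cast
    ring
  refine ⟨fun m hm hm' => ⟨?_, ?_⟩, fun m hm hm' => ⟨?_, ?_⟩⟩
  · rw [hu'] at hm'
    obtain ⟨A, b, -, hA, hb, hb', e⟩ := exists_column_offset (Nat.zero_le (α + 1)) hN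
      (by simpa using Nat.lt_of_succ_le hm) (by push_cast; linarith)
    push_cast at hb'
    refine ⟨A, b, by omega, hb, ?_, by rw [e, hu']; ring⟩
    have : (b : ℚ) ≤ u - q + 2 + A := by rw [hu']; linarith
    exact_mod_cast this
  · intro a b ha hb hb' e
    have hb'' : (b : ℚ) ≤ u - q + 2 + a := by exact_mod_cast hb'
    rw [hu'] at hb'' e ⊢
    rw [hM.eq_of_offset (A := a) (b := b) (by omega) hN hT (Nat.zero_le a) (by omega) hb
      (by push_cast; linarith) (by linarith), e]
    ring
  · rw [hu'] at hm ⊢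
    have hY : (columnSum q (α + t) (α + 1) : ℚ) + 1 ≤ m + columnSum q α (α + 1) := by
      have := hN (α + 1) (Nat.zero_le _) le_rfl
      push_cast at this
      linarith
    obtain ⟨c, hc⟩ := Nat.exists_eq_add_of_le (show columnSum q (α + t) (α + 1) + 1 ≤
      m + columnSum q α (α + 1) by exact_mod_cast hY)
    refine ⟨c + 1, by omega, ?_⟩
    have hc' : (m : ℚ) + columnSum q α (α + 1) =
      columnSum q (α + t) (α + 1) + 1 + c := by exact_mod_cast hc
    have := hN (α + 1) (Nat.zero_le _) le_rfl
    push_cast at this ⊢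
    linarith
  · intro c hc e
    have hc1 : (1 : ℚ) ≤ c := by exact_mod_cast hc
    rw [hu₂'] at hm'
    rw [hu'] at e ⊢
    rw [hM.eq_of_ge (lo := α + 1) (by omega) (by omega) (by omega)
      (by rw [hN _ (Nat.zero_le _) le_rfl]; push_cast; linarith)
      (by rw [hNq]; linarith), e]
    ring

end Cases

/-! ### Specialisation to Reed-Muller codes and the final case analysis. -/

section Weights

variable {F : Type*} [Field F] [Fintype F]

theorem isColumnWeight_rghw {u₂ : ℤ} {α t : ℕ}
    (hu : u₂ = 2 * ((Fintype.card F : ℤ) - 1) - α - t) :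
    IsColumnWeight (Fintype.card F) α (α + t)
      (rghw (reedMuller F (u₂ + t) 2) (reedMuller F u₂ 2)) :=
  fun _ _ hA h1 h2 => rghw_reedMuller_eq (Nat.le_add_right α t) (by omega)
    (by push_cast; omega) hA h1 h2

theorem isColumnWeight_ghw {u α t : ℕ} (hu : (u : ℤ) = 2 * ((Fintype.card F : ℤ) - 1) - α)
    (ht : t = u + 1) :
    IsColumnWeight (Fintype.card F) α (α + t) (ghw (reedMuller F u 2)) := by
  rw [show α + t = 2 * Fintype.card F - 1 by omega]
  exact fun _ _ hA h1 h2 => ghw_reedMuller_eq (by omega) hu hA h1 h2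

lemma finrank_reedMuller_sub {u₁ u₂ : ℤ} {α β : ℕ}
    (hu₁ : u₁ = 2 * ((Fintype.card F : ℤ) - 1) - α)
    (hu₂ : u₂ = 2 * ((Fintype.card F : ℤ) - 1) - β) :
    (Module.finrank F (reedMuller F u₁ 2) : ℚ) - Module.finrank F (reedMuller F u₂ 2) =
      columnSum (Fintype.card F) β (Fintype.card F) -
        columnSum (Fintype.card F) α (Fintype.card F) := by
  have h1 := finrank_reedMuller_add (F := F) hu₁
  have h2 := finrank_reedMuller_add (F := F) hu₂
  have h : (Module.finrank F (reedMuller F u₁ 2) : ℚ) +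
      columnSum (Fintype.card F) α (Fintype.card F) = Module.finrank F (reedMuller F u₂ 2) +
        columnSum (Fintype.card F) β (Fintype.card F) := by exact_mod_cast h1.trans h2.symm
  linarith

lemma finrank_reedMuller_eq {u : ℤ} {α : ℕ} (hu : u = 2 * ((Fintype.card F : ℤ) - 1) - α) :
    (Module.finrank F (reedMuller F u 2) : ℚ) =
      (Fintype.card F : ℚ) ^ 2 - columnSum (Fintype.card F) α (Fintype.card F) := by
  have h : (Module.finrank F (reedMuller F u 2) : ℚ) +
      columnSum (Fintype.card F) α (Fintype.card F) = (Fintype.card F : ℚ) ^ 2 := by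
    exact_mod_cast finrank_reedMuller_add (F := F) hu
  linarith

end Weights

theorem mainTheorem5 {F : Type*} [Field F] [Fintype F] (q : ℕ) (hq : Fintype.card F = q) :
    -- relative generalized Hamming weights of C₁ = RM_q(u₂ + t, 2) with respect to C₂ = RM_q(u₂, 2)
    (∀ (u₂ : ℤ) (t : ℕ) (C₁ C₂ : Submodule F ((Fin 2 → F) → F)),
      -1 ≤ u₂ → 1 ≤ t → u₂ + t ≤ 2 * ((q : ℤ) - 1) →
      C₂ = reedMuller F u₂ 2 → C₁ = reedMuller F (u₂ + t) 2 →
      -- first case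
      (0 ≤ u₂ - q + 2 →
        ((Module.finrank F C₁ : ℚ) - Module.finrank F C₂ =
          t * (2 * q - u₂ - t - 2) + t * (t + 1) / 2) ∧
        (∀ m : ℕ, 1 ≤ m → (m : ℚ) ≤ t * (2 * q - u₂ - t - 2) →
          (∃ a b : ℕ, (a : ℤ) ≤ 2 * (q - 1) - u₂ - t - 1 ∧ 1 ≤ b ∧ b ≤ t ∧ m = a * t + b) ∧
          (∀ a b : ℕ, (a : ℤ) ≤ 2 * (q - 1) - u₂ - t - 1 → 1 ≤ b → b ≤ t → m = a * t + b →
            (rghw C₁ C₂ m : ℚ) = (2 * q - 2 - u₂ - a / 2) * (a + 1) + b - t)) ∧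
        (∀ m : ℕ, t * (2 * q - u₂ - t - 2) + 1 ≤ (m : ℚ) →
          (m : ℚ) ≤ t * (2 * q - u₂ - t - 2) + t * (t + 1) / 2 →
          (∃ c : ℕ, 1 ≤ c ∧ (c : ℚ) ≤ t * (t + 1) / 2 ∧
            (m : ℚ) = t * (2 * q - u₂ - t - 2) + c) ∧
          (∀ c : ℕ, 1 ≤ c → (c : ℚ) ≤ t * (t + 1) / 2 →
            (m : ℚ) = t * (2 * q - u₂ - t - 2) + c →
            (rghw C₁ C₂ m : ℚ) = 1 / 2 * (2 * q - u₂ - t - 2) * (2 * q - u₂ + t - 1) + c))) ∧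
      -- second case
      (u₂ - q + t + 1 ≤ 0 →
        ((Module.finrank F C₁ : ℚ) - Module.finrank F C₂ =
          t * (t + 1) / 2 + t * (u₂ + 1)) ∧
        (∀ m : ℕ, 1 ≤ m → (m : ℚ) ≤ t * (t + 1) / 2 →
          (∃ a b : ℕ, a + 1 ≤ t ∧ 1 ≤ b ∧ b ≤ a + 1 ∧ (m : ℚ) = a * (a + 1) / 2 + b) ∧
          (∀ a b : ℕ, a + 1 ≤ t → 1 ≤ b → b ≤ a + 1 → (m : ℚ) = a * (a + 1) / 2 + b →
            (rghw C₁ C₂ m : ℚ) = q * (q - u₂ - t + a) + b - a - 1)) ∧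
        (∀ m : ℕ, t * (t + 1) / 2 + 1 ≤ (m : ℚ) →
          (m : ℚ) ≤ t * (t + 1) / 2 + t * (u₂ + 1) →
          (∃ a b : ℕ, (a : ℤ) ≤ u₂ ∧ 1 ≤ b ∧ b ≤ t ∧ (m : ℚ) = t * (t + 1) / 2 + a * t + b) ∧
          (∀ a b : ℕ, (a : ℤ) ≤ u₂ → 1 ≤ b → b ≤ t → (m : ℚ) = t * (t + 1) / 2 + a * t + b →
            (rghw C₁ C₂ m : ℚ) = q * (q + a - u₂) + b - t - 1 - a * (a + 3) / 2))) ∧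
      -- third case
      (u₂ - q + 2 < 0 → 0 < u₂ - q + t + 1 →
        ((Module.finrank F C₁ : ℚ) - Module.finrank F C₂ =
          (2 * q - u₂) * (u₂ + t) + 3 * (q - u₂) - q ^ 2 - 2 - t * (t + 3) / 2) ∧
        (t ≤ q →
          (∀ m : ℕ, 1 ≤ m → (m : ℚ) ≤ 1 / 2 * (q - u₂ - 2) * (2 * t - q + u₂ + 1) + t →
            (∃ a b : ℕ, (a : ℤ) ≤ q - u₂ - 2 ∧ 1 ≤ b ∧ (b : ℤ) ≤ u₂ + t - q + a + 2 ∧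
              (m : ℚ) = a * (u₂ + t - q + 1) + a * (a + 1) / 2 + b) ∧
            (∀ a b : ℕ, (a : ℤ) ≤ q - u₂ - 2 → 1 ≤ b → (b : ℤ) ≤ u₂ + t - q + a + 2 →
              (m : ℚ) = a * (u₂ + t - q + 1) + a * (a + 1) / 2 + b →
              (rghw C₁ C₂ m : ℚ) = (a + 2) * (q - 1) - u₂ - t + b)) ∧
          (∀ m : ℕ, 1 / 2 * (q - u₂ - 2) * (2 * t - q + u₂ + 1) + t + 1 ≤ (m : ℚ) →
            (m : ℚ) ≤ 1 / 2 * (q - u₂ - 2) * (2 * t - q + u₂ + 1) + t * (q - t) →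
            (∃ a b : ℕ, (a : ℤ) ≤ q - t - 2 ∧ 1 ≤ b ∧ b ≤ t ∧
              (m : ℚ) = 1 / 2 * (q - u₂ - 2) * (2 * t - q + u₂ + 1) + (a + 1) * t + b) ∧
            (∀ a b : ℕ, (a : ℤ) ≤ q - t - 2 → 1 ≤ b → b ≤ t →
              (m : ℚ) = 1 / 2 * (q - u₂ - 2) * (2 * t - q + u₂ + 1) + (a + 1) * t + b →
              (rghw C₁ C₂ m : ℚ) = q * (q - u₂ + a) - a * (a + 3) / 2 - t + b - 1)) ∧
          (∀ m : ℕ, 1 ≤ m →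
            1 / 2 * (q - u₂ - 2) * (2 * t - q + u₂ + 1) + t * (q - t) + 1 ≤ (m : ℚ) →
            (m : ℚ) ≤ (2 * q - u₂) * (u₂ + t) + 3 * (q - u₂) - q ^ 2 - 2 - t * (t + 3) / 2 →
            (∃ c : ℕ, 1 ≤ c ∧
              (c : ℚ) ≤ 1 / 2 * ((t + 1) ^ 2 - (q - u₂ - 1) ^ 2 + q - u₂ - t - 2) ∧
              (m : ℚ) = 1 / 2 * (q - u₂ - 2) * (2 * t - q + u₂ + 1) + t * (q - t) + c) ∧
            (∀ c : ℕ, 1 ≤ c →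
              (c : ℚ) ≤ 1 / 2 * ((t + 1) ^ 2 - (q - u₂ - 1) ^ 2 + q - u₂ - t - 2) →
              (m : ℚ) = 1 / 2 * (q - u₂ - 2) * (2 * t - q + u₂ + 1) + t * (q - t) + c →
              (rghw C₁ C₂ m : ℚ) =
                1 / 2 * (3 * q ^ 2 - 2 * u₂ * q - 3 * q - t ^ 2 - t) + c))) ∧
        (q < t → ∀ u : ℤ, u = u₂ + t →
          (∀ m : ℕ, 1 ≤ m → (m : ℚ) ≤ q * (u + 2) - u * (u + 3) / 2 - 1 →
            (∃ a b : ℕ, (a : ℤ) ≤ 2 * (q - 1) - u ∧ 1 ≤ b ∧ (b : ℤ) ≤ u - q + 2 + a ∧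
              (m : ℚ) = a * (u - q + 1) + a * (a + 1) / 2 + b) ∧
            (∀ a b : ℕ, (a : ℤ) ≤ 2 * (q - 1) - u → 1 ≤ b → (b : ℤ) ≤ u - q + 2 + a →
              (m : ℚ) = a * (u - q + 1) + a * (a + 1) / 2 + b →
              (rghw C₁ C₂ m : ℚ) = (a + 2) * (q - 1) - u + b)) ∧
          (∀ m : ℕ, q * (u + 2) - u * (u + 3) / 2 ≤ (m : ℚ) →
            (m : ℚ) ≤ (2 * q - u₂) * (u₂ + t) + 3 * (q - u₂) - q ^ 2 - 2 - t * (t + 3) / 2 →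
            (∃ c : ℕ, 1 ≤ c ∧ (m : ℚ) = q * (u + 2) - u * (u + 3) / 2 - 1 + c) ∧
            (∀ c : ℕ, 1 ≤ c → (m : ℚ) = q * (u + 2) - u * (u + 3) / 2 - 1 + c →
              (rghw C₁ C₂ m : ℚ) = q * (2 * q - u - 1) + c))))) ∧
    -- generalized Hamming weights of C₁ = RM_q(u, 2)
    (∀ (u : ℕ) (C₁ : Submodule F ((Fin 2 → F) → F)),
      (u : ℤ) ≤ 2 * ((q : ℤ) - 1) → C₁ = reedMuller F u 2 →
      ((u : ℤ) - q + 1 ≤ 0 →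
        ((Module.finrank F C₁ : ℚ) = (u + 1) * (u + 2) / 2) ∧
        (∀ r : ℕ, 1 ≤ r → (r : ℚ) ≤ (u + 1) * (u + 2) / 2 →
          (∃ a b : ℕ, a ≤ u ∧ 1 ≤ b ∧ b ≤ a + 1 ∧ (r : ℚ) = a * (a + 1) / 2 + b) ∧
          (∀ a b : ℕ, a ≤ u → 1 ≤ b → b ≤ a + 1 → (r : ℚ) = a * (a + 1) / 2 + b →
            (ghw C₁ r : ℚ) = q * (q - u + a) + b - a - 1))) ∧
      (0 < (u : ℤ) - q + 1 →
        ((Module.finrank F C₁ : ℚ) = q * (2 * u - q + 3) - u * (u + 3) / 2 - 1) ∧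
        (∀ r : ℕ, 1 ≤ r → (r : ℚ) ≤ q * (u + 2) - u * (u + 3) / 2 - 1 →
          (∃ a b : ℕ, (a : ℤ) ≤ 2 * (q - 1) - u ∧ 1 ≤ b ∧ (b : ℤ) ≤ u - q + 2 + a ∧
            (r : ℚ) = a * (u - q + 1) + a * (a + 1) / 2 + b) ∧
          (∀ a b : ℕ, (a : ℤ) ≤ 2 * (q - 1) - u → 1 ≤ b → (b : ℤ) ≤ u - q + 2 + a →
            (r : ℚ) = a * (u - q + 1) + a * (a + 1) / 2 + b →
            (ghw C₁ r : ℚ) = (a + 2) * (q - 1) - u + b)) ∧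
        (∀ r : ℕ, q * (u + 2) - u * (u + 3) / 2 ≤ (r : ℚ) →
          (r : ℚ) ≤ q * (2 * u - q + 3) - u * (u + 3) / 2 - 1 →
          (∃ c : ℕ, 1 ≤ c ∧ (c : ℚ) ≤ q * (u - q + 1) ∧
            (r : ℚ) = q * (u + 2) - u * (u + 3) / 2 - 1 + c) ∧
          (∀ c : ℕ, 1 ≤ c → (c : ℚ) ≤ q * (u - q + 1) →
            (r : ℚ) = q * (u + 2) - u * (u + 3) / 2 - 1 + c →
            (ghw C₁ r : ℚ) = q * (2 * q - u - 1) + c)))) := by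
  subst hq
  have hq2 : 2 ≤ Fintype.card F := Fintype.one_lt_card
  refine ⟨?_, ?_⟩
  · rintro u₂ t C₁ C₂ hu₂ ht hut rfl rfl
    obtain ⟨α, hα⟩ : ∃ α : ℕ, u₂ = 2 * ((Fintype.card F : ℤ) - 1) - α - t :=
      ⟨(2 * ((Fintype.card F : ℤ) - 1) - u₂ - t).toNat, by omega⟩
    have hM := isColumnWeight_rghw hα
    have hdim := finrank_reedMuller_sub (F := F) (u₁ := u₂ + t) (u₂ := u₂) (α := α) (β := α + t)
      (by omega) (by push_cast; omega)
    have hu' : (u₂ : ℚ) = 2 * ((Fintype.card F : ℚ) - 1) - α - t := by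
      rw [hα]
      push_cast
      ring
    refine ⟨fun h => ⟨?_, hM.band_low hα (by omega)⟩,
      fun h => ⟨?_, hM.band_high hα hu₂ (by omega)⟩, fun h1 h2 => ⟨?_,
        fun h => hM.band_middle hα ht (by omega) (by omega) h,
        fun h u hu => hM.band_wide hα hu₂ (by omega) h hu⟩⟩
    · rw [hdim, columnSum_of_ge (by omega) (by omega), columnSum_of_ge (by omega) (by omega), hu']
      push_cast
      ring
    · rw [hdim, columnSum_of_le_add (by omega) (by omega) (by omega),
        columnSum_of_le_add (by omega) (by omega) (by omega), hu']
      push_cast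
      ring
    · rw [hdim, columnSum_of_le_add (by omega) (by omega) (by omega),
        columnSum_of_ge (by omega) (by omega), hu']
      push_cast
      ring
  · rintro u C₁ hu rfl
    obtain ⟨α, hα⟩ : ∃ α : ℕ, (u : ℤ) = 2 * ((Fintype.card F : ℤ) - 1) - α :=
      ⟨(2 * ((Fintype.card F : ℤ) - 1) - u).toNat, by omega⟩
    -- Ordinary weights use `u₂ = -1` and width `t = u + 1`. Only `band_high` (`t ≤ q`) and
    -- `band_wide` (`t > q`) can then occur.
    have hα' : (-1 : ℤ) = 2 * ((Fintype.card F : ℤ) - 1) - α - (u + 1 : ℕ) := by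
      push_cast
      omega
    have hM := isColumnWeight_ghw hα rfl
    have hdim := finrank_reedMuller_eq (F := F) hα
    have hu' : (u : ℚ) = 2 * ((Fintype.card F : ℚ) - 1) - α := by exact_mod_cast hα
    refine ⟨fun h => ⟨?_, fun r hr hr' => ?_⟩, fun h => ⟨?_, fun r hr hr' => ?_, fun r hr hr' => ?_⟩⟩
    · rw [hdim, columnSum_of_le_add (by omega) (by omega) (by omega), hu']
      ring
    -- With `u₂ = -1` the second range of `band_high` is empty, so the first covers every `r`.
    · obtain ⟨⟨a, b, h1, h2⟩, h3⟩ := (hM.band_high hα' le_rfl (by omega)).1 r hr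
        (by push_cast; linarith)
      refine ⟨⟨a, b, by omega, h2⟩, fun a b ha hb hb' e => ?_⟩
      rw [h3 a b (by omega) hb hb' e]
      push_cast
      ring
    · rw [hdim, columnSum_of_ge (by omega) (by omega), hu']
      ring
    · have := (hM.band_wide hα' le_rfl (by omega) (by omega) (u := u) (by push_cast; ring)).1 r hr
        (by push_cast; exact hr')
      exact_mod_cast this
    · obtain ⟨⟨c, hc, e⟩, h3⟩ := (hM.band_wide hα' le_rfl (by omega) (by omega) (u := u)
        (by push_cast; ring)).2 r (by push_cast; exact hr) (by push_cast; linarith)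
      push_cast at e h3
      exact ⟨⟨c, hc, by linarith, e⟩, fun c hc _ e => h3 c hc e⟩
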